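/- Let $H$ be a (real or complex) Hilbert space with norm $|\cdot|$ and scalar product $\langle\cdot,\cdot\rangle$, and let $G$ be a Hilbert space over the same field. Assume (A1) $A:D(A)\subset H\to H$ is self-adjoint and nonnegative, has a compact resolvent, and there is $\omega>0$ with $|Au|\ge\omega|u|$ for all $u\in D(A)$. For an integer $k\ge 0$ let $H_k=D(A^{k/2})$ with norm $|u|_k=|A^{k/2}u|$ (so $H_0=H$, $H_2=D(A)$), and for $k\in\mathbb Z$ let $$e_k(u,v)=\tfrac12\big(|A^{k/2}u|^2+|A^{(k-1)/2}v|^2\big).$$ A solution on $[0,T]$ of $w''+Aw=f\in L^2([0,T];H)$ is a function $w\in C([0,T];H_1)\cap C^1([0,T];H)$ that satisfies the equation weakly, i.e. $\langle w'(t),\varphi\rangle=\langle w'(0),\varphi\rangle-\int_0^t\langle w,A\varphi\rangle\,ds+\int_0^t\langle f,\varphi\rangle\,ds$ for all $\varphi\in D(A)$, $t\in[0,T]$; we write $W=(w,w')$. Let $n\ge2$ and let $C_{i\,i-1}$, $2\le i\le n$, be bounded operators on $H$. Assume $(A2)_n$ with $\Pi_i=C_{i\,i-1}$: for every $i\in\{2,\dots,n\}$,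 - $C_{i\,i-1}^*$ maps $H_k$ boundedly into $H_k$ for $k\in\{0,1,\dots,n-i+1\}$; - $|C_{i\,i-1}w|^2\le\|C_{i\,i-1}\|\,\langle C_{i\,i-1}w,w\rangle$ for all $w\in H$; - there is $\alpha_i>0$ with $\alpha_i|C_{i\,i-1}w|^2\le\langle C_{i\,i-1}w,w\rangle$ for all $w\in H$ (in the complex case the real part of the scalar product suffices). Let $\mathbf{B}_n^*$ satisfy $(A4)_n$: $\mathbf{B}_n^*$ is a bounded linear operator from $H_2\times H$ to $G$, and for every $T>0$ there is $D_n(T)>0$ such that all solutions $w$ of $w''+Aw=f\in L^2([0,T];H)$ with $w\in C([0,T];H_2)$ satisfy $$\int_0^T\|\mathbf{B}_n^*(w,w')\|_G^2\,dt\le D_n(T)\Big(e_1(W)(0)+e_1(W)(T)+\int_0^Te_1(W)(t)\,dt+\int_0^T|f|^2\,dt\Big).$$ By density, $(A4)_n$ gives a meaning to $\mathbf{B}_n^*(w,w')\in L^2([0,T];G)$ for every solution $w$ of $w''+Aw=f\in L^2([0,T];H)$: it is the $L^2([0,T];G)$-limit of $\mathbf{B}_n^*(w_j,w_j')$ for solutions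 $w_j\in C([0,T];H_2)$ with sources $f_j$ such that $(w_j,w_j')\to(w,w')$ in $C([0,T];H_1\times H)$ and $f_j\to f$ in $L^2([0,T];H)$. Consider the conditions $(A5)_n$: there is $T_0>0$ such that for every $T>T_0$ there is $R_n(T)>0$ such that all solutions of $w''+Aw=0$ satisfy $\int_0^T\|\mathbf{B}_n^*(w,w')\|_G^2\,dt\ge R_n(T)\,e_1(W)(0)$; $(A3)_n$ (with $\Pi_i=C_{i\,i-1}$): for every $i\in\{2,\dots,n\}$ there is $T_{0,i}>0$ such that for every $T>T_{0,i}$ there is $\gamma_i(T)>0$ such that all solutions of $w''+Aw=0$ satisfy $\int_0^T|C_{i\,i-1}w'|^2\,dt\ge\gamma_i(T)\,e_1(W)(0)$. Assume that $(A5)_n$ fails or that $(A3)_n$ fails. Then there is no $T_n^*>0$ such that for all $T>T_n^*$ the following property holds: $(OBS)_n$: there is $C>0$ such that for all initial data in $H_1^n\times H^n$ the solution of $$u_1''+Au_1=0,\qquad u_i''+Au_i+C_{i\,i-1}u_{i-1}=0\quad(2\le i\le n)$$ satisfies, with $U_i=(u_i,u_i')$, $$C\sum_{i=1}^n e_{1+i-n}(U_i)(0)\le\int_0^T\|\mathbf{B}_n^*U_n\|_G^2\,dt.$$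 -/

import Mathlib

open MeasureTheory Filter Topology Set

noncomputable section

namespace Cascade

variable {𝕜 : Type*} [RCLike 𝕜] {H : Type*} [NormedAddCommGroup H] [InnerProductSpace 𝕜 H]
  [CompleteSpace H]

/-- `A` has a compact resolvent: for some scalar `z` the operator `z - A : D(A) → H` is a bijection
whose inverse is a compact operator on `H`. -/
def HasCompactResolvent (A : H →ₗ.[𝕜] H) : Prop :=
  ∃ (z : 𝕜) (R : H →L[𝕜] H), IsCompactOperator R ∧
    (∀ x : H, ∃ u : A.domain, (u : H) = R x ∧ z • (u : H) - A u = x) ∧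
    (∀ u : A.domain, R (z • (u : H) - A u) = u)

/-- Assumption (A1): `A` is self-adjoint (in particular densely defined), nonnegative,
`|A u| ≥ ω |u|` on `D(A)` for some `ω > 0`, and `A` has a compact resolvent. -/
structure A1 (A : H →ₗ.[𝕜] H) : Prop where
  selfAdjoint : IsSelfAdjoint A
  nonneg : ∀ u : A.domain, 0 ≤ RCLike.re (inner 𝕜 (A u) (u : H))
  coercive : ∃ ω : ℝ, 0 < ω ∧ ∀ u : A.domain, ω * ‖(u : H)‖ ≤ ‖A u‖
  compactResolvent : HasCompactResolvent A

/-- The eigenspace `{u ∈ D(A) : A u = μ u}`. -/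
def eigenspace (A : H →ₗ.[𝕜] H) (μ : ℝ) : Submodule 𝕜 H where
  carrier := {u | ∃ x : A.domain, (x : H) = u ∧ A x = (μ : 𝕜) • u}
  zero_mem' := ⟨0, by simp, by simp⟩
  add_mem' := by
    rintro a b ⟨x, rfl, hx⟩ ⟨y, rfl, hy⟩
    exact ⟨x + y, by simp, by rw [A.map_add, hx, hy, smul_add]⟩
  smul_mem' := by
    rintro c a ⟨x, rfl, hx⟩
    exact ⟨c • x, by simp, by rw [A.map_smul, hx, smul_comm]⟩

/-- The orthogonal projection of `H` onto the eigenspace of `A` for `μ`. (Eigenspaces of a closed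
operator are closed, so the topological closure changes nothing for a self-adjoint `A`.) -/
def eigenProj (A : H →ₗ.[𝕜] H) (μ : ℝ) : H →L[𝕜] H :=
  (eigenspace A μ).topologicalClosure.starProjection

/-- The domain `D(A^s)` of the power `A^s = ∑_μ μ^s P_μ` of a positive self-adjoint operator
with compact resolvent; `μ` runs over the eigenvalues of `A` (`P_μ = 0` for all other `μ`).
The space `H_k` is `powDom A (k / 2)`. -/
def powDom (A : H →ₗ.[𝕜] H) (s : ℝ) : Set H :=
  {u | Summable fun μ : ℝ => ((μ ^ s : ℝ) : 𝕜) • eigenProj A μ u}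

/-- `A^s u = ∑_μ μ^s P_μ u`, for `u ∈ D(A^s)`. The norm of `H_k` is `|u|_k = ‖A^{k/2} u‖`. For
`s ≤ 0` the operator `A^s` is defined on all of `H`. -/
def fracPow (A : H →ₗ.[𝕜] H) (s : ℝ) (u : H) : H :=
  ∑' μ : ℝ, ((μ ^ s : ℝ) : 𝕜) • eigenProj A μ u

/-- The energy of level `k`, `e_k(u, v) = (|A^{k/2} u|² + |A^{(k-1)/2} v|²) / 2`. -/
def energy (A : H →ₗ.[𝕜] H) (k : ℤ) (u v : H) : ℝ :=
  (‖fracPow A ((k : ℝ) / 2) u‖ ^ 2 + ‖fracPow A (((k : ℝ) - 1) / 2) v‖ ^ 2) / 2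

/-- `(w, w')` is a (finite energy) solution on `[0, T]` of `w'' + A w = f ∈ L²([0, T]; H)`:
`(w, w')` is continuous with values in `H_1 × H`, `w'` is the time derivative of `w`, and
`(w')' = - A w + f` holds in integrated weak form, tested against the elements of `D(A)`.
The initial data are `(w 0, w' 0) ∈ H_1 × H`. -/
structure IsSol (A : H →ₗ.[𝕜] H) (T : ℝ) (f w w' : ℝ → H) : Prop where
  source : MemLp f 2 (volume.restrict (Icc 0 T))
  mem : ∀ t ∈ Icc 0 T, w t ∈ powDom A (1 / 2)
  cont : ContinuousOn (fun t => fracPow A (1 / 2) (w t)) (Icc 0 T)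
  cont' : ContinuousOn w' (Icc 0 T)
  deriv : ∀ φ : H, ∀ t ∈ Icc 0 T,
    inner 𝕜 φ (w t) = inner 𝕜 φ (w 0) + ∫ s in (0 : ℝ)..t, inner 𝕜 φ (w' s)
  equation : ∀ φ : A.domain, ∀ t ∈ Icc 0 T,
    inner 𝕜 (φ : H) (w' t) = inner 𝕜 (φ : H) (w' 0)
      - (∫ s in (0 : ℝ)..t, inner 𝕜 (A φ) (w s)) + ∫ s in (0 : ℝ)..t, inner 𝕜 (φ : H) (f s)

/-- A solution that moreover is continuous with values in `H_2 = D(A)`. -/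
def IsStrongSol (A : H →ₗ.[𝕜] H) (T : ℝ) (f : ℝ → H) (w : ℝ → A.domain) (w' : ℝ → H) : Prop :=
  IsSol A T f (fun t => (w t : H)) w' ∧ ContinuousOn (fun t => A (w t)) (Icc 0 T)

/-- `(u_1, …, u_n)` with velocities `(v_1, …, v_n)` is a solution on `[0, T]` of the bi-diagonal
cascade system `u_1'' + A u_1 = 0`, `u_i'' + A u_i + C_{i,i-1} u_{i-1} = 0` for `2 ≤ i ≤ n`, with
initial data in `H_1^n × H^n`. Here `C i` stands for `C_{i,i-1}`; only the indices `1, …, n` of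
`u`, `v` and `2, …, n` of `C` matter. -/
def IsCascadeSol (A : H →ₗ.[𝕜] H) (C : ℕ → H →L[𝕜] H) (n : ℕ) (T : ℝ) (u v : ℕ → ℝ → H) : Prop :=
  IsSol A T (fun _ => 0) (u 1) (v 1) ∧
    ∀ i ∈ Finset.Icc 2 n, IsSol A T (fun t => -C i (u (i - 1) t)) (u i) (v i)

/-- `L ∈ 𝓛(H_k)`: `L` maps `H_k` into itself and is bounded for the norm of `H_k`. -/
def BoundedOnH (A : H →ₗ.[𝕜] H) (k : ℕ) (L : H →L[𝕜] H) : Prop :=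
  ∃ M : ℝ, ∀ u ∈ powDom A ((k : ℝ) / 2), L u ∈ powDom A ((k : ℝ) / 2) ∧
    ‖fracPow A ((k : ℝ) / 2) (L u)‖ ≤ M * ‖fracPow A ((k : ℝ) / 2) u‖

/-- Assumption (A2)_n on the couplings `C i = C_{i,i-1}` and the operators `P i = Π_i`. -/
def A2 (A : H →ₗ.[𝕜] H) (C P : ℕ → H →L[𝕜] H) (n : ℕ) : Prop :=
  ∀ i ∈ Finset.Icc 2 n,
    (∀ k ∈ Finset.Icc 0 (n - i + 1), BoundedOnH A k (ContinuousLinearMap.adjoint (C i))) ∧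
    (∀ w : H, ‖C i w‖ ^ 2 ≤ ‖C i‖ * RCLike.re (inner 𝕜 (C i w) w)) ∧
    (∃ α : ℝ, 0 < α ∧ ∀ w : H, α * ‖P i w‖ ^ 2 ≤ RCLike.re (inner 𝕜 (C i w) w))

/-- Assumption (A3)_n on the operators `P i = Π_i`. -/
def A3 (A : H →ₗ.[𝕜] H) (P : ℕ → H →L[𝕜] H) (n : ℕ) : Prop :=
  ∀ i ∈ Finset.Icc 2 n, ∃ T₀ : ℝ, 0 < T₀ ∧ ∀ T : ℝ, T₀ < T → ∃ γ : ℝ, 0 < γ ∧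
    ∀ w w' : ℝ → H, IsSol A T (fun _ => 0) w w' →
      γ * energy A 1 (w 0) (w' 0) ≤ ∫ t in (0 : ℝ)..T, ‖P i (w' t)‖ ^ 2

variable {G : Type*} [NormedAddCommGroup G] [InnerProductSpace 𝕜 G]

/-- Assumption (A4)_n on the observation operator `B`: it belongs to `𝓛(H_2 × H; G)` and it is
admissible. Since `B (w, w')` makes sense a priori only for `w` with values in `H_2`, the
admissibility inequality is required for those solutions; it is what allows to
define `B (w, w')` for all solutions, see `IsObservation`. -/
def A4 (A : H →ₗ.[𝕜] H) (B : A.domain × H →ₗ[𝕜] G) : Prop :=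
  (∃ M : ℝ, ∀ (u : A.domain) (v : H), ‖B (u, v)‖ ≤ M * (‖A u‖ + ‖v‖)) ∧
  ∀ T : ℝ, 0 < T → ∃ D : ℝ, 0 < D ∧
    ∀ (f : ℝ → H) (w : ℝ → A.domain) (w' : ℝ → H), IsStrongSol A T f w w' →
      ∫ t in (0 : ℝ)..T, ‖B (w t, w' t)‖ ^ 2 ≤
        D * (energy A 1 (w 0) (w' 0) + energy A 1 (w T) (w' T)
          + (∫ t in (0 : ℝ)..T, energy A 1 (w t) (w' t)) + ∫ t in (0 : ℝ)..T, ‖f t‖ ^ 2)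

/-- `y ∈ L²([0, T]; G)` is the observation `B (w, w')` of the finite energy solution `(w, w')` of
`w'' + A w = f`, in the sense of extension by density: it is the `L²` limit of `B (w_j, w_j')`
for solutions `(w_j, w_j')` with values in `H_2 × H`, with sources `f_j`, such that
`(w_j, w_j') → (w, w')` in `C([0, T]; H_1 × H)` and `f_j → f` in `L²([0, T]; H)`. Under (A4)_n every
finite energy solution has exactly one observation (up to null sets), and it is `B (w, w')` itself
if `w` is continuous with values in `H_2`. -/
def IsObservation (A : H →ₗ.[𝕜] H) (B : A.domain × H →ₗ[𝕜] G) (T : ℝ) (f w w' : ℝ → H)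
    (y : ℝ → G) : Prop :=
  MemLp y 2 (volume.restrict (Icc 0 T)) ∧
  ∃ (fs : ℕ → ℝ → H) (ws : ℕ → ℝ → A.domain) (ws' : ℕ → ℝ → H),
    (∀ j, IsStrongSol A T (fs j) (ws j) (ws' j)) ∧
    TendstoUniformlyOn (fun j t => fracPow A (1 / 2) (ws j t : H)) (fun t => fracPow A (1 / 2) (w t))
      atTop (Icc 0 T) ∧
    TendstoUniformlyOn ws' w' atTop (Icc 0 T) ∧
    Tendsto (fun j => eLpNorm (fun t => fs j t - f t) 2 (volume.restrict (Icc 0 T)))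
      atTop (𝓝 0) ∧
    Tendsto (fun j => eLpNorm (fun t => B (ws j t, ws' j t) - y t) 2
      (volume.restrict (Icc 0 T))) atTop (𝓝 0)

/-- Assumption (A5)_n: observability of the single equation `w'' + A w = 0` through `B`. -/
def A5 (A : H →ₗ.[𝕜] H) (B : A.domain × H →ₗ[𝕜] G) : Prop :=
  ∃ T₀ : ℝ, 0 < T₀ ∧ ∀ T : ℝ, T₀ < T → ∃ R : ℝ, 0 < R ∧
    ∀ (w w' : ℝ → H) (y : ℝ → G), IsSol A T (fun _ => 0) w w' →
      IsObservation A B T (fun _ => 0) w w' y →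
      R * energy A 1 (w 0) (w' 0) ≤ ∫ t in (0 : ℝ)..T, ‖y t‖ ^ 2

/-- The observability inequality (OBS)_n at time `T`, for all solutions of the cascade system with
initial data in `H_1^n × H^n`; `y` is the observation `B (u_n, u_n')` of the last component. -/
def OBS (A : H →ₗ.[𝕜] H) (C : ℕ → H →L[𝕜] H) (n : ℕ) (B : A.domain × H →ₗ[𝕜] G) (T : ℝ) : Prop :=
  ∃ c : ℝ, 0 < c ∧ ∀ (u v : ℕ → ℝ → H) (y : ℝ → G), IsCascadeSol A C n T u v →
    IsObservation A B T (fun t => -C n (u (n - 1) t)) (u n) (v n) y →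
    c * ∑ i ∈ Finset.Icc 1 n, energy A (1 + (i : ℤ) - (n : ℤ)) (u i 0) (v i 0) ≤
      ∫ t in (0 : ℝ)..T, ‖y t‖ ^ 2

end Cascade

end

noncomputable section

namespace Cascade

/-! ### Spectral decomposition and bounded functional calculus for `A`. -/

section Spectral

variable {𝕜 : Type*} [RCLike 𝕜] {H : Type*} [NormedAddCommGroup H] [InnerProductSpace 𝕜 H]
  [CompleteSpace H] {A : H →ₗ.[𝕜] H}

/-! The contrapositive is proved: observability of the cascade for all large times forces both the
observability of the last equation and that of the free equation through each coupling.

The first implication (`A5_of_OBS`) needs only the cascade whose components before the last vanish: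
the last one is then a free solution, and its energy enters the sum at level 1.

For the second (`A3_of_OBS`), fix a coupling index `i` and a smooth free solution `w`. Put `V_j = 0`
for `j < i - 1` and `V_{i-1} = w`. For `j ≥ i` let `V_j` start from rest and solve the wave equation
with source `-C_j V_{j-1}'`, where for `j = i` the velocity `w'` is multiplied by a smooth cutoff in
time vanishing for `t ≤ 0`. Once the cutoff equals 1, the derivatives `u_j = V_j^{(n-j)}` solve the
cascade, since each equation is differentiated once less than the one before it.

Two facts are then compared. Differentiating a free solution in time lowers the energy level by one
(`A1.energy_iteratedDeriv`), so the term of index `i - 1` in the observability sum is exactly the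
level-1 energy of `w`. The last component is not differentiated and is driven from rest, so
admissibility and the energy estimate, iterated along the chain (`A1.stageSource_le`), bound its
observation by the integral of `‖C_i w'‖²`. This is `OBS.exists_energy_le`. The waiting time for the
cutoff costs one unit of observation time.

Spectral truncation extends the inequality from smooth to finite energy solutions
(`A1.energy_le_of_smooth`). The spectral theory and Duhamel's formula supply the smooth solutions
used in the construction. -/

theorem A1.inner_map_left (hA : A1 A) (u v : A.domain) :
    inner 𝕜 (A u) (v : H) = inner 𝕜 (u : H) (A v) := by
  have h := LinearPMap.adjoint_isFormalAdjoint hA.selfAdjoint.dense_domain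
  have e : A.adjoint = A := LinearPMap.isSelfAdjoint_def.1 hA.selfAdjoint
  rw [e] at h
  exact h u v

/-- A vector orthogonal to the range of `A` vanishes. -/
theorem A1.eq_zero_of_orthogonal_range (hA : A1 A) {y : H}
    (hy : ∀ u : A.domain, inner 𝕜 y (A u) = 0) : y = 0 := by
  have hd := hA.selfAdjoint.dense_domain
  have e : A.adjoint = A := LinearPMap.isSelfAdjoint_def.1 hA.selfAdjoint
  have hmem : y ∈ A.adjoint.domain :=
    LinearPMap.mem_adjoint_domain_of_exists y ⟨0, fun x => by rw [inner_zero_left, hy x]⟩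
  rw [e] at hmem
  have h0 : A ⟨y, hmem⟩ = 0 := by
    refine hd.eq_zero_of_inner_left 𝕜 (fun v hv => ?_)
    exact (hA.inner_map_left ⟨y, hmem⟩ ⟨v, hv⟩).trans (hy _)
  obtain ⟨ω, hω, h⟩ := hA.coercive
  have := h ⟨y, hmem⟩
  rw [h0, norm_zero] at this
  have : ‖y‖ ≤ 0 := by
    by_contra! hc
    have := mul_pos hω hc
    linarith
  exact norm_le_zero_iff.1 this

/-- The inverse of `A` is a compact operator. -/
theorem A1.exists_inverse (hA : A1 A) : ∃ K : H →L[𝕜] H, IsCompactOperator K ∧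
    (∀ x : H, ∃ u : A.domain, (u : H) = K x ∧ A u = x) ∧ ∀ u : A.domain, K (A u) = u := by
  obtain ⟨z, R, hR, hR1, hR2⟩ := hA.compactResolvent
  obtain ⟨ω, hω, hc⟩ := hA.coercive
  -- This is `A R`. If `N` is invertible, then `R N⁻¹` inverts `A` and is compact because `R` is.
  let N : H →L[𝕜] H := z • R - 1
  have hN : ∀ x, ∃ u : A.domain, (u : H) = R x ∧ A u = N x := by
    intro x
    obtain ⟨u, hu, hx⟩ := hR1 x
    refine ⟨u, hu, ?_⟩
    simp only [N, sub_apply, smul_apply, one_apply_eq_self, ← hu]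
    conv_rhs => rw [← hx]
    abel
  -- Coercivity of `A` at `R x` controls `R x` by `N x`, and `x = z R x - N x`.
  have hanti : ∀ x, ‖x‖ ≤ (‖z‖ / ω + 1) * ‖N x‖ := by
    intro x
    obtain ⟨u, hu, hx⟩ := hN x
    have h1 : ‖R x‖ ≤ ‖N x‖ / ω := by
      rw [le_div_iff₀ hω, mul_comm, ← hu, ← hx]; exact hc u
    have h2 : x = z • R x - N x := by simp [N]
    calc ‖x‖ ≤ ‖z • R x‖ + ‖N x‖ := by
          conv_lhs => rw [h2]
          exact norm_sub_le _ _
      _ ≤ ‖z‖ * (‖N x‖ / ω) + ‖N x‖ := by rw [norm_smul]; gcongr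
      _ = _ := by ring
  have hantiN : AntilipschitzWith (‖z‖ / ω + 1).toNNReal N := by
    refine ContinuousLinearMap.antilipschitz_of_bound N (fun x => ?_)
    rw [Real.coe_toNNReal _ (by positivity)]
    exact hanti x
  have hker : LinearMap.ker (N : H →ₗ[𝕜] H) = ⊥ := LinearMap.ker_eq_bot.2 hantiN.injective
  have hclosed : IsClosed (LinearMap.range (N : H →ₗ[𝕜] H) : Set H) := by
    have := hantiN.isClosed_range N.uniformContinuous
    exact this
  have hrange : LinearMap.range (N : H →ₗ[𝕜] H) = ⊤ := by
    have : CompleteSpace (LinearMap.range (N : H →ₗ[𝕜] H)) := hclosed.completeSpace_coe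
    rw [← Submodule.orthogonal_eq_bot_iff, Submodule.eq_bot_iff]
    intro y hy
    refine hA.eq_zero_of_orthogonal_range (fun u => ?_)
    -- `N` sends `(z - A) u` to `A u`, so its range contains the range of `A`, which has trivial
    -- orthogonal complement.
    obtain ⟨u', hu', hx⟩ := hN (z • (u : H) - A u)
    rw [hR2 u] at hu'
    have : u' = u := Subtype.ext hu'
    subst this
    rw [hx]
    exact (Submodule.mem_orthogonal' _ _).1 hy _ ⟨_, rfl⟩
  let e := ContinuousLinearEquiv.ofBijective N hker hrange
  have he : ∀ x, N (e.symm x) = x := fun x => by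
    have := e.apply_symm_apply x
    exact this
  refine ⟨R.comp (e.symm : H →L[𝕜] H), hR.comp_clm _, fun x => ?_, fun u => ?_⟩
  · obtain ⟨u, hu, hx⟩ := hN (e.symm x)
    exact ⟨u, hu, by rw [hx, he]⟩
  · obtain ⟨v, hv, hx⟩ := hN (e.symm (A u))
    rw [he] at hx
    have h := hc (v - u)
    rw [A.map_sub, hx, sub_self, norm_zero] at h
    have : ‖((v - u : A.domain) : H)‖ ≤ 0 := by
      by_contra! hc
      have := mul_pos hω hc
      linarith
    have : (v : H) = u := by
      have := norm_le_zero_iff.1 this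
      simpa [sub_eq_zero] using this
    simp [← this, hv]

/-- The bounded inverse of `A`. -/
def A1.inv (hA : A1 A) : H →L[𝕜] H := hA.exists_inverse.choose

theorem A1.isCompactOperator_inv (hA : A1 A) : IsCompactOperator hA.inv :=
  hA.exists_inverse.choose_spec.1

theorem A1.inv_mem (hA : A1 A) (x : H) : hA.inv x ∈ A.domain := by
  obtain ⟨u, hu, -⟩ := hA.exists_inverse.choose_spec.2.1 x
  have : (u : H) = hA.inv x := hu
  rw [← this]
  exact u.2

theorem A1.map_inv (hA : A1 A) (x : H) : A ⟨hA.inv x, hA.inv_mem x⟩ = x := by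
  obtain ⟨u, hu, hx⟩ := hA.exists_inverse.choose_spec.2.1 x
  have : (⟨hA.inv x, hA.inv_mem x⟩ : A.domain) = u := Subtype.ext hu.symm
  rw [this, hx]

theorem A1.inv_map (hA : A1 A) (u : A.domain) : hA.inv (A u) = u :=
  hA.exists_inverse.choose_spec.2.2 u

theorem A1.inner_inv_left (hA : A1 A) (x y : H) :
    inner 𝕜 (hA.inv x) y = inner 𝕜 x (hA.inv y) := by
  have := hA.inner_map_left ⟨_, hA.inv_mem x⟩ ⟨_, hA.inv_mem y⟩
  rw [hA.map_inv, hA.map_inv] at this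
  exact this.symm

/-- Replaces the unbounded eigenvalue equation by a closed condition on a bounded operator, free of
domain questions. -/
theorem A1.mem_eigenspace_iff (hA : A1 A) {μ : ℝ} {u : H} :
    u ∈ eigenspace A μ ↔ u = (μ : 𝕜) • hA.inv u := by
  constructor
  · rintro ⟨x, rfl, hx⟩
    rw [← map_smul, ← hx, hA.inv_map]
  · intro h
    rw [← map_smul] at h
    refine ⟨⟨hA.inv ((μ : 𝕜) • u), hA.inv_mem _⟩, h.symm, hA.map_inv _⟩

theorem A1.isClosed_eigenspace (hA : A1 A) (μ : ℝ) : IsClosed (eigenspace A μ : Set H) := by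
  have : (eigenspace A μ : Set H) = {u | u = (μ : 𝕜) • hA.inv u} :=
    Set.ext fun u => hA.mem_eigenspace_iff
  rw [this]
  exact isClosed_eq continuous_id (by fun_prop)

theorem A1.eigenspace_orthogonal (hA : A1 A) {μ ν : ℝ} (h : μ ≠ ν) {u v : H}
    (hu : u ∈ eigenspace A μ) (hv : v ∈ eigenspace A ν) : inner 𝕜 u v = 0 := by
  obtain ⟨x, rfl, hx⟩ := hu
  obtain ⟨y, rfl, hy⟩ := hv
  have := hA.inner_map_left x y
  rw [hx, hy, inner_smul_left, inner_smul_right, RCLike.conj_ofReal] at this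
  have h' : ((μ : 𝕜) - ν) * inner 𝕜 (x : H) (y : H) = 0 := by rw [sub_mul, this, sub_self]
  rcases mul_eq_zero.1 h' with h' | h'
  · exact absurd (by exact_mod_cast sub_eq_zero.1 h') h
  · exact h'

/-- The eigenvalues of `A` are bounded from below by a positive constant. -/
theorem A1.exists_le_eigenvalue (hA : A1 A) :
    ∃ ω : ℝ, 0 < ω ∧ ∀ μ : ℝ, ∀ u ∈ eigenspace A μ, u ≠ 0 → ω ≤ μ := by
  obtain ⟨ω, hω, hc⟩ := hA.coercive
  refine ⟨ω, hω, ?_⟩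
  rintro μ u ⟨x, rfl, hx⟩ hu
  have hpos : 0 < ‖(x : H)‖ := norm_pos_iff.2 hu
  have h1 := hA.nonneg x
  rw [hx, inner_smul_left, RCLike.conj_ofReal, RCLike.re_ofReal_mul, inner_self_eq_norm_sq] at h1
  have hμ : 0 ≤ μ := nonneg_of_mul_nonneg_left h1 (by positivity)
  have h2 := hc x
  rw [hx, norm_smul, RCLike.norm_ofReal, abs_of_nonneg hμ] at h2
  exact le_of_mul_le_mul_right h2 hpos

theorem A1.orthogonalFamily (hA : A1 A) : OrthogonalFamily 𝕜 (fun μ : ℝ => eigenspace A μ)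
    fun μ => (eigenspace A μ).subtypeₗᵢ :=
  fun _ _ h u v => hA.eigenspace_orthogonal h u.2 v.2

/-- The spectral theorem for the compact symmetric operator `A⁻¹`: its eigenvalues are real and
nonzero, and their inverses are eigenvalues of `A` with the same eigenvectors. -/
theorem A1.iSup_eigenspace_orthogonal (hA : A1 A) : (⨆ μ : ℝ, eigenspace A μ)ᗮ = ⊥ := by
  have hsym : (hA.inv : H →ₗ[𝕜] H).IsSymmetric := fun x y => hA.inner_inv_left x y
  have h := ContinuousLinearMap.orthogonalComplement_iSup_eigenspaces_eq_bot
    hA.isCompactOperator_inv hsym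
  rw [eq_bot_iff, ← h]
  refine Submodule.orthogonal_le (iSup_le fun κ u hu => ?_)
  rw [Module.End.mem_eigenspace_iff] at hu
  by_cases hu0 : u = 0
  · rw [hu0]; exact zero_mem _
  have hev : Module.End.HasEigenvalue (hA.inv : H →ₗ[𝕜] H) κ :=
    Module.End.hasEigenvalue_of_hasEigenvector (x := u) ⟨Module.End.mem_eigenspace_iff.2 hu, hu0⟩
  have hκ : ((RCLike.re κ : ℝ) : 𝕜) = κ := RCLike.conj_eq_iff_re.1 (hsym.conj_eigenvalue_eq_self hev)
  have hu' : hA.inv u = κ • u := hu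
  have hκ0 : κ ≠ 0 := by
    rintro rfl
    have h1 := hA.map_inv u
    have : (⟨hA.inv u, hA.inv_mem u⟩ : A.domain) = 0 := Subtype.ext (by simp [hu'])
    rw [this, A.map_zero] at h1
    exact hu0 h1.symm
  refine Submodule.mem_iSup_of_mem (RCLike.re κ)⁻¹ (hA.mem_eigenspace_iff.2 ?_)
  rw [hu', smul_smul, RCLike.ofReal_inv, hκ, inv_mul_cancel₀ hκ0, one_smul]

theorem A1.eigenProj_mem (hA : A1 A) (μ : ℝ) (x : H) : eigenProj A μ x ∈ eigenspace A μ := by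
  have h : eigenProj A μ x ∈ (eigenspace A μ).topologicalClosure :=
    Submodule.starProjection_apply_mem _ _
  rwa [(hA.isClosed_eigenspace μ).submodule_topologicalClosure_eq] at h

theorem eigenProj_of_mem {μ : ℝ} {x : H} (hx : x ∈ eigenspace A μ) : eigenProj A μ x = x :=
  Submodule.starProjection_eq_self_iff.2 ((eigenspace A μ).le_topologicalClosure hx)

theorem inner_eigenProj_left (μ : ℝ) (x y : H) :
    inner 𝕜 (eigenProj A μ x) y = inner 𝕜 x (eigenProj A μ y) :=
  Submodule.inner_starProjection_left_eq_right _ _ _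

theorem A1.eigenProj_of_mem_ne (hA : A1 A) {μ ν : ℝ} (h : μ ≠ ν) {x : H}
    (hx : x ∈ eigenspace A ν) : eigenProj A μ x = 0 := by
  rw [← inner_self_eq_zero (𝕜 := 𝕜)]
  conv_lhs => rw [inner_eigenProj_left]
  rw [eigenProj_of_mem (hA.eigenProj_mem μ x)]
  exact hA.eigenspace_orthogonal h.symm hx (hA.eigenProj_mem μ x)

theorem A1.eigenProj_comp (hA : A1 A) (μ ν : ℝ) (x : H) :
    eigenProj A μ (eigenProj A ν x) = if μ = ν then eigenProj A ν x else 0 := by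
  split_ifs with h
  · rw [h]; exact eigenProj_of_mem (hA.eigenProj_mem ν x)
  · exact hA.eigenProj_of_mem_ne h (hA.eigenProj_mem ν x)

/-- Makes the conventional values of `μ ^ s`, `√μ` and division by zero at `μ ≤ 0` harmless in every
sum over real `μ`. -/
theorem A1.eigenProj_eq_zero_of_nonpos (hA : A1 A) {μ : ℝ} (hμ : μ ≤ 0) (x : H) :
    eigenProj A μ x = 0 := by
  obtain ⟨ω, hω, h⟩ := hA.exists_le_eigenvalue
  by_contra hc
  linarith [h μ _ (hA.eigenProj_mem μ x) hc]

theorem A1.eigenProj_inv (hA : A1 A) (μ : ℝ) (x : H) :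
    (μ : 𝕜) • eigenProj A μ (hA.inv x) = eigenProj A μ x := by
  refine ext_inner_left 𝕜 fun y => ?_
  rw [inner_smul_right, ← inner_eigenProj_left, ← inner_eigenProj_left, ← hA.inner_inv_left]
  conv_rhs => rw [hA.mem_eigenspace_iff.1 (hA.eigenProj_mem μ y)]
  rw [inner_smul_left, RCLike.conj_ofReal]

theorem A1.inv_eigenProj (hA : A1 A) (μ : ℝ) (x : H) :
    (μ : 𝕜) • hA.inv (eigenProj A μ x) = eigenProj A μ x :=
  (hA.mem_eigenspace_iff.1 (hA.eigenProj_mem μ x)).symm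

theorem A1.eigenProj_tsum (hA : A1 A) {v : ℝ → H} (hv : ∀ ν, v ν ∈ eigenspace A ν) {x : H}
    (h : HasSum v x) (μ : ℝ) : eigenProj A μ x = v μ := by
  have h1 := (eigenProj A μ).hasSum h
  have h2 : HasSum (fun ν => eigenProj A μ (v ν)) (v μ) := by
    have := hasSum_single (f := fun ν => eigenProj A μ (v ν)) μ
      fun ν hν => hA.eigenProj_of_mem_ne hν.symm (hv ν)
    rwa [eigenProj_of_mem (hv μ)] at this
  exact h1.unique h2

/-- The spectral decomposition of a vector. -/
theorem A1.hasSum_eigenProj (hA : A1 A) (x : H) : HasSum (fun μ => eigenProj A μ x) x := by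
  have : ∀ μ : ℝ, CompleteSpace (eigenspace A μ) :=
    fun μ => (hA.isClosed_eigenspace μ).completeSpace_coe
  have hV : IsHilbertSum 𝕜 (fun μ : ℝ => eigenspace A μ) fun μ => (eigenspace A μ).subtypeₗᵢ := by
    refine IsHilbertSum.mkInternal _ hA.orthogonalFamily ?_
    rw [top_le_iff, Submodule.topologicalClosure_eq_top_iff]
    exact hA.iSup_eigenspace_orthogonal
  have h := hV.hasSum_linearIsometryEquiv_symm (hV.linearIsometryEquiv x)
  rw [LinearIsometryEquiv.symm_apply_apply] at h
  have h' := hA.eigenProj_tsum (fun ν => (hV.linearIsometryEquiv x ν).2) h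
  simp only [h']
  exact h

theorem A1.ext_eigenProj (hA : A1 A) {x y : H} (h : ∀ μ, eigenProj A μ x = eigenProj A μ y) :
    x = y := by
  have hx := hA.hasSum_eigenProj x
  simp only [h] at hx
  exact hx.unique (hA.hasSum_eigenProj y)

theorem norm_eigenProj_sq (μ : ℝ) (x : H) :
    ‖eigenProj A μ x‖ ^ 2 = RCLike.re (inner 𝕜 x (eigenProj A μ x)) := by
  have h : eigenProj A μ (eigenProj A μ x) = eigenProj A μ x :=
    Submodule.starProjection_eq_self_iff.2 (Submodule.starProjection_apply_mem _ _)
  rw [← inner_self_eq_norm_sq (𝕜 := 𝕜), inner_eigenProj_left, h]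

/-- Parseval's identity. -/
theorem A1.hasSum_norm_eigenProj_sq (hA : A1 A) (x : H) :
    HasSum (fun μ => ‖eigenProj A μ x‖ ^ 2) (‖x‖ ^ 2) := by
  have h := (RCLike.reCLM (K := 𝕜)).hasSum ((innerSL 𝕜 x).hasSum (hA.hasSum_eigenProj x))
  simp only [innerSL_apply_apply, RCLike.reCLM_apply, inner_self_eq_norm_sq] at h
  simpa only [norm_eigenProj_sq] using h

theorem A1.norm_le_of_eigenProj (hA : A1 A) {x y : H} {c : ℝ} (hc : 0 ≤ c)
    (h : ∀ μ, ‖eigenProj A μ x‖ ≤ c * ‖eigenProj A μ y‖) : ‖x‖ ≤ c * ‖y‖ := by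
  have h1 := hasSum_le (fun μ => ?_) (hA.hasSum_norm_eigenProj_sq x)
    ((hA.hasSum_norm_eigenProj_sq y).mul_left (c ^ 2))
  · rw [← mul_pow] at h1
    exact (sq_le_sq₀ (norm_nonneg _) (by positivity)).1 h1
  · rw [← mul_pow]
    exact pow_le_pow_left₀ (norm_nonneg _) (h μ) 2

/-- `L = m(A)`: the operator `L` acts on the eigenspace for `μ` as multiplication by `m μ`. -/
def IsMultiplier (A : H →ₗ.[𝕜] H) (m : ℝ → ℝ) (L : H →L[𝕜] H) : Prop :=
  ∀ μ x, eigenProj A μ (L x) = (m μ : 𝕜) • eigenProj A μ x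

/-- By orthogonality of the modes, square summability of the coefficients is preserved under bounded
factors. The bound is asked only at actual eigenvalues, so that negative powers qualify. -/
theorem A1.exists_isMultiplier (hA : A1 A) (m : ℝ → ℝ) (M : ℝ)
    (hM : ∀ μ, ∀ u ∈ eigenspace A μ, u ≠ 0 → |m μ| ≤ M) : ∃ L, IsMultiplier A m L := by
  have hM' : ∀ μ x, ‖(m μ : 𝕜) • eigenProj A μ x‖ ≤ |M| * ‖eigenProj A μ x‖ := by
    intro μ x
    rw [norm_smul, RCLike.norm_ofReal]
    by_cases h : eigenProj A μ x = 0
    · simp [h]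
    · exact mul_le_mul_of_nonneg_right
        ((hM μ _ (hA.eigenProj_mem μ x) h).trans (le_abs_self M)) (norm_nonneg _)
  have hmem : ∀ x μ, (m μ : 𝕜) • eigenProj A μ x ∈ eigenspace A μ :=
    fun x μ => Submodule.smul_mem _ _ (hA.eigenProj_mem μ x)
  have hs : ∀ x, Summable fun μ => (m μ : 𝕜) • eigenProj A μ x := by
    intro x
    have h := hA.orthogonalFamily.summable_iff_norm_sq_summable
      (fun μ => ⟨(m μ : 𝕜) • eigenProj A μ x, hmem x μ⟩)
    refine h.2 (Summable.of_nonneg_of_le (fun _ => sq_nonneg _) (fun μ => ?_)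
      ((hA.hasSum_norm_eigenProj_sq x).summable.mul_left (|M| ^ 2)))
    rw [← mul_pow]
    exact pow_le_pow_left₀ (norm_nonneg _) (hM' μ x) 2
  let L₀ : H →ₗ[𝕜] H :=
    { toFun := fun x => ∑' μ, (m μ : 𝕜) • eigenProj A μ x
      map_add' := fun x y => by
        rw [← (hs x).tsum_add (hs y)]
        simp only [map_add, smul_add]
      map_smul' := fun c x => by
        rw [RingHom.id_apply, ← (hs x).tsum_const_smul c]
        simp only [map_smul]
        exact tsum_congr fun μ => smul_comm _ _ _ }
  have hL : ∀ μ x, eigenProj A μ (L₀ x) = (m μ : 𝕜) • eigenProj A μ x :=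
    fun μ x => hA.eigenProj_tsum (hmem x) (hs x).hasSum μ
  refine ⟨L₀.mkContinuous |M| fun x => hA.norm_le_of_eigenProj (abs_nonneg M) fun μ => ?_, hL⟩
  rw [hL]
  exact hM' μ x

theorem IsMultiplier.norm_le (hA : A1 A) {m : ℝ → ℝ} {L : H →L[𝕜] H} (hL : IsMultiplier A m L)
    {M : ℝ} (hM0 : 0 ≤ M) (hM : ∀ μ, |m μ| ≤ M) (x : H) : ‖L x‖ ≤ M * ‖x‖ := by
  refine hA.norm_le_of_eigenProj hM0 fun μ => ?_
  rw [hL, norm_smul, RCLike.norm_ofReal]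
  gcongr
  exact hM μ

theorem IsMultiplier.sub {m m' : ℝ → ℝ} {L L' : H →L[𝕜] H} (hL : IsMultiplier A m L)
    (hL' : IsMultiplier A m' L') : IsMultiplier A (fun μ => m μ - m' μ) (L - L') := fun μ x => by
  rw [sub_apply, map_sub, hL, hL', RCLike.ofReal_sub, sub_smul]

theorem IsMultiplier.inner_left (hA : A1 A) {m : ℝ → ℝ} {L : H →L[𝕜] H} (hL : IsMultiplier A m L)
    (x y : H) : inner 𝕜 (L x) y = inner 𝕜 x (L y) := by
  have h1 := (innerSL 𝕜 (L x)).hasSum (hA.hasSum_eigenProj y)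
  have h2 := (innerSL 𝕜 x).hasSum (hA.hasSum_eigenProj (L y))
  simp only [innerSL_apply_apply] at h1 h2
  refine h1.unique (h2.congr_fun fun μ => ?_) 
  rw [hL, inner_smul_right, ← inner_eigenProj_left, hL, inner_smul_left, RCLike.conj_ofReal,
    inner_eigenProj_left]

theorem A1.fracPow_eq (hA : A1 A) {s : ℝ} {u y : H}
    (h : ∀ μ : ℝ, ((μ ^ s : ℝ) : 𝕜) • eigenProj A μ u = eigenProj A μ y) :
    u ∈ powDom A s ∧ fracPow A s u = y := by
  have hs := hA.hasSum_eigenProj y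
  simp only [← h] at hs
  exact ⟨hs.summable, hs.tsum_eq⟩

theorem A1.eigenProj_fracPow (hA : A1 A) {s : ℝ} {u : H} (h : u ∈ powDom A s) (μ : ℝ) :
    eigenProj A μ (fracPow A s u) = ((μ ^ s : ℝ) : 𝕜) • eigenProj A μ u :=
  hA.eigenProj_tsum (fun ν => Submodule.smul_mem _ _ (hA.eigenProj_mem ν u))
    (Summable.hasSum h) μ

theorem A1.eigenProj_map (hA : A1 A) (u : A.domain) (μ : ℝ) :
    eigenProj A μ (A u) = (μ : 𝕜) • eigenProj A μ (u : H) := by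
  rw [← hA.eigenProj_inv, hA.inv_map]

theorem A1.fracPow_map (hA : A1 A) (s : ℝ) (u : A.domain) :
    fracPow A s (A u) = fracPow A (s + 1) (u : H) := by
  refine tsum_congr fun μ => ?_
  rcases le_or_gt μ 0 with h | h
  · rw [hA.eigenProj_eq_zero_of_nonpos h, hA.eigenProj_eq_zero_of_nonpos h, smul_zero, smul_zero]
  · rw [hA.eigenProj_map, smul_smul, Real.rpow_add_one h.ne', RCLike.ofReal_mul]

theorem fracPow_neg (s : ℝ) (u : H) : fracPow A s (-u) = -fracPow A s u := by
  simp only [fracPow, map_neg, smul_neg, tsum_neg]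

theorem fracPow_zero_right (s : ℝ) : fracPow A s (0 : H) = 0 := by simp [fracPow]

theorem A1.fracPow_zero_left (hA : A1 A) (u : H) : fracPow A 0 u = u :=
  (hA.fracPow_eq fun μ => by simp).2

/-- The energies of consecutive levels of a free solution and of its time derivative agree. -/
theorem A1.energy_shift (hA : A1 A) (k : ℤ) (u : A.domain) (v : H) :
    energy A (k - 1) v (-A u) = energy A k (u : H) v := by
  unfold energy
  rw [fracPow_neg, norm_neg, hA.fracPow_map]
  push_cast
  rw [show ((k : ℝ) - 1 - 1) / 2 + 1 = k / 2 by ring, add_comm]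

theorem energy_nonneg (k : ℤ) (u v : H) : 0 ≤ energy A k u v := by
  unfold energy; positivity

theorem A1.energy_one (hA : A1 A) (u v : H) :
    energy A 1 u v = (‖fracPow A (1 / 2) u‖ ^ 2 + ‖v‖ ^ 2) / 2 := by
  unfold energy
  norm_num [hA.fracPow_zero_left]

theorem A1.exists_invSqrt (hA : A1 A) :
    ∃ Q : H →L[𝕜] H, IsMultiplier A (fun μ => μ ^ (-(1 / 2) : ℝ)) Q := by
  obtain ⟨ω, hω, h⟩ := hA.exists_le_eigenvalue
  refine hA.exists_isMultiplier _ (ω ^ (-(1 / 2) : ℝ)) fun μ u hu hu0 => ?_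
  have := h μ u hu hu0
  rw [abs_of_nonneg (Real.rpow_nonneg (hω.le.trans this) _)]
  exact Real.rpow_le_rpow_of_nonpos hω this (by norm_num)

/-- The operator `A^{-1/2}`. -/
def A1.invSqrt (hA : A1 A) : H →L[𝕜] H := hA.exists_invSqrt.choose

theorem A1.isMultiplier_invSqrt (hA : A1 A) :
    IsMultiplier A (fun μ => μ ^ (-(1 / 2) : ℝ)) hA.invSqrt := hA.exists_invSqrt.choose_spec

theorem A1.invSqrt_powDom (hA : A1 A) (x : H) :
    hA.invSqrt x ∈ powDom A (1 / 2) ∧ fracPow A (1 / 2) (hA.invSqrt x) = x := by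
  refine hA.fracPow_eq fun μ => ?_
  rcases le_or_gt μ 0 with h | h
  · rw [hA.eigenProj_eq_zero_of_nonpos h, hA.eigenProj_eq_zero_of_nonpos h, smul_zero]
  · rw [hA.isMultiplier_invSqrt, smul_smul, ← RCLike.ofReal_mul, ← Real.rpow_add h]
    simp

theorem A1.invSqrt_invSqrt (hA : A1 A) (x : H) : hA.invSqrt (hA.invSqrt x) = hA.inv x := by
  refine hA.ext_eigenProj fun μ => ?_
  rcases le_or_gt μ 0 with h | h
  · rw [hA.eigenProj_eq_zero_of_nonpos h, hA.eigenProj_eq_zero_of_nonpos h]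
  · have h1 : (μ : 𝕜) ≠ 0 := by exact_mod_cast h.ne'
    refine smul_right_injective H h1 ?_
    have h2 : μ * (μ ^ (-(1 / 2) : ℝ) * μ ^ (-(1 / 2) : ℝ)) = 1 := by
      rw [← Real.rpow_add h]
      norm_num [Real.rpow_neg_one, h.ne']
    simp only [hA.eigenProj_inv, hA.isMultiplier_invSqrt _ _, smul_smul, ← RCLike.ofReal_mul]
    rw [h2, RCLike.ofReal_one, one_smul]

theorem A1.invSqrt_fracPow (hA : A1 A) {u : H} (hu : u ∈ powDom A (1 / 2)) :
    hA.invSqrt (fracPow A (1 / 2) u) = u := by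
  refine hA.ext_eigenProj fun μ => ?_
  rcases le_or_gt μ 0 with h | h
  · rw [hA.eigenProj_eq_zero_of_nonpos h, hA.eigenProj_eq_zero_of_nonpos h]
  · rw [hA.isMultiplier_invSqrt, hA.eigenProj_fracPow hu, smul_smul, ← RCLike.ofReal_mul,
      ← Real.rpow_add h]
    simp

theorem A1.fracPow_inv (hA : A1 A) (x : H) :
    hA.inv x ∈ powDom A (1 / 2) ∧ fracPow A (1 / 2) (hA.inv x) = hA.invSqrt x := by
  rw [← hA.invSqrt_invSqrt]
  exact hA.invSqrt_powDom _

theorem A1.norm_fracPow_inv_sq (hA : A1 A) (x : H) :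
    ‖fracPow A (1 / 2) (hA.inv x)‖ ^ 2 = RCLike.re (inner 𝕜 x (hA.inv x)) := by
  rw [(hA.fracPow_inv x).2, ← hA.invSqrt_invSqrt, ← hA.isMultiplier_invSqrt.inner_left hA,
    inner_self_eq_norm_sq]

end Spectral

/-! ### Duhamel's formula, smooth solutions and their energy. -/

section Wave

set_option linter.unusedSectionVars false

open scoped ContDiff

variable {𝕜 : Type*} [RCLike 𝕜] {H : Type*} [NormedAddCommGroup H] [InnerProductSpace 𝕜 H]
  [CompleteSpace H] {A : H →ₗ.[𝕜] H}

/-- The Lipschitz constant does not depend on `μ`, so `A^{-1/2} sin (s A^{1/2})` is continuous in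
`s` for the operator norm. -/
theorem abs_sin_sqrt_div_sub_le (μ s t : ℝ) :
    |Real.sin (√μ * s) / √μ - Real.sin (√μ * t) / √μ| ≤ |s - t| := by
  rcases (Real.sqrt_nonneg μ).eq_or_lt with h | h
  · simp [← h]
  · rw [← sub_div, abs_div, abs_of_pos h, div_le_iff₀ h]
    refine (Real.abs_sin_sub_sin_le _ _).trans_eq ?_
    rw [← mul_sub, abs_mul, abs_of_pos h, mul_comm]

theorem A1.exists_sine (hA : A1 A) (s : ℝ) :
    ∃ L, IsMultiplier A (fun μ => Real.sin (√μ * s) / √μ) L :=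
  hA.exists_isMultiplier _ |s| fun μ _ _ _ => by simpa using abs_sin_sqrt_div_sub_le μ s 0

/-- The operator `A^{-1/2} sin (s A^{1/2})`. -/
def A1.sine (hA : A1 A) (s : ℝ) : H →L[𝕜] H := (hA.exists_sine s).choose

theorem A1.isMultiplier_sine (hA : A1 A) (s : ℝ) :
    IsMultiplier A (fun μ => Real.sin (√μ * s) / √μ) (hA.sine s) := (hA.exists_sine s).choose_spec

theorem A1.continuous_sine (hA : A1 A) : Continuous hA.sine := by
  have : LipschitzWith 1 hA.sine := by
    refine LipschitzWith.of_dist_le_mul fun s t => ?_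
    rw [dist_eq_norm, NNReal.coe_one, one_mul, Real.dist_eq]
    exact ContinuousLinearMap.opNorm_le_bound _ (abs_nonneg _)
      (((hA.isMultiplier_sine s).sub (hA.isMultiplier_sine t)).norm_le hA (abs_nonneg _)
        fun μ => abs_sin_sqrt_div_sub_le μ s t)
  exact this.continuous

theorem hasDerivAt_of_contDiff {E : Type*} [NormedAddCommGroup E] [NormedSpace ℝ E] {f : ℝ → E}
    (hf : ContDiff ℝ ∞ f) (t : ℝ) : HasDerivAt f (deriv f t) t :=
  ((contDiff_infty_iff_deriv.1 hf).1 t).hasDerivAt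

theorem deriv_eq_zero_of_Iic {E : Type*} [NormedAddCommGroup E] [NormedSpace ℝ E] {f : ℝ → E}
    (hf : ContDiff ℝ ∞ f) (h0 : ∀ t ≤ 0, f t = 0) : ∀ t ≤ 0, deriv f t = 0 := by
  have hc : IsClosed {t | deriv f t = 0} :=
    isClosed_eq (contDiff_infty_iff_deriv.1 hf).2.continuous continuous_const
  have hs : Iio (0 : ℝ) ⊆ {t | deriv f t = 0} := by
    intro t ht
    have : f =ᶠ[𝓝 t] fun _ => 0 := by
      filter_upwards [Iio_mem_nhds (show t < 0 from ht)] with s hs using h0 s (le_of_lt hs)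
    simpa using this.deriv_eq
  intro t ht
  have := closure_minimal hs hc
  rw [closure_Iio] at this
  exact this ht

theorem memLp_of_continuousOn_Icc {E : Type*} [NormedAddCommGroup E] {f : ℝ → E} {a b : ℝ}
    (hf : ContinuousOn f (Icc a b)) : MemLp f 2 (volume.restrict (Icc a b)) := by
  obtain ⟨M, hM⟩ := isCompact_Icc.exists_bound_of_continuousOn hf
  exact MemLp.of_bound (hf.aestronglyMeasurable measurableSet_Icc) M
    ((ae_restrict_iff' measurableSet_Icc).2 (Eventually.of_forall hM))

variable [NormedSpace ℝ H]

/-- Duhamel's formula for the solution of `z'' + A z = f` with vanishing initial data. -/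
def A1.duhamel (hA : A1 A) (f : ℝ → H) (t : ℝ) : H := ∫ s in (0 : ℝ)..t, hA.sine s (f (t - s))

theorem A1.continuous_sine_apply (hA : A1 A) {f : ℝ → H} (hf : Continuous f) (t : ℝ) :
    Continuous fun s => hA.sine s (f (t - s)) :=
  hA.continuous_sine.clm_apply (by fun_prop)

/-- A source vanishing in the past allows a fixed upper limit; differentiation in `t` then acts only
on `f`, without boundary terms. -/
theorem A1.duhamel_of_le (hA : A1 A) {f : ℝ → H} (hf : Continuous f) (h0 : ∀ t ≤ 0, f t = 0)
    {t L : ℝ} (h : t ≤ L) : hA.duhamel f t = ∫ s in (0 : ℝ)..L, hA.sine s (f (t - s)) := by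
  have hc := hA.continuous_sine_apply hf t
  have h2 : ∫ s in t..L, hA.sine s (f (t - s)) = 0 := by
    rw [intervalIntegral.integral_congr (g := fun _ => 0)]
    · simp
    · intro s hs
      rw [uIcc_of_le h] at hs
      simp [h0 (t - s) (by linarith [hs.1])]
  rw [← intervalIntegral.integral_add_adjacent_intervals (hc.intervalIntegrable 0 t)
    (hc.intervalIntegrable t L), h2, add_zero]
  rfl

theorem A1.duhamel_eq_zero (hA : A1 A) {f : ℝ → H} (hf : Continuous f) (h0 : ∀ t ≤ 0, f t = 0) :
    ∀ t ≤ 0, hA.duhamel f t = 0 := fun t ht => by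
  rw [hA.duhamel_of_le hf h0 ht, intervalIntegral.integral_same]

variable [IsScalarTower ℝ 𝕜 H]

theorem hasDerivAt_clm (L : H →L[𝕜] H) {f : ℝ → H} {f' : H} {t : ℝ} (h : HasDerivAt f f' t) :
    HasDerivAt (fun s => L (f s)) (L f') t :=
  (L.restrictScalars ℝ).hasFDerivAt.comp_hasDerivAt t h

theorem contDiff_clm (L : H →L[𝕜] H) {f : ℝ → H} {n : WithTop ℕ∞} (h : ContDiff ℝ n f) :
    ContDiff ℝ n fun s => L (f s) :=
  (L.restrictScalars ℝ).contDiff.comp h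

theorem iteratedDeriv_clm (L : H →L[𝕜] H) {f : ℝ → H} (h : ContDiff ℝ ∞ f) (k : ℕ) :
    iteratedDeriv k (fun s => L (f s)) = fun s => L (iteratedDeriv k f s) := by
  induction k generalizing f with
  | zero => simp
  | succ k ih =>
    rw [iteratedDeriv_succ', iteratedDeriv_succ', ← ih (contDiff_infty_iff_deriv.1 h).2]
    congr 1
    exact funext fun s => (hasDerivAt_clm L (hasDerivAt_of_contDiff h s)).deriv

theorem A1.hasDerivAt_duhamel (hA : A1 A) {f : ℝ → H} (hf : ContDiff ℝ ∞ f)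
    (h0 : ∀ t ≤ 0, f t = 0) (t : ℝ) : HasDerivAt (hA.duhamel f) (hA.duhamel (deriv f) t) t := by
  have hf' := (contDiff_infty_iff_deriv.1 hf).2
  have heq : hA.duhamel f =ᶠ[𝓝 t] fun x => ∫ s in (0 : ℝ)..(t + 1), hA.sine s (f (x - s)) := by
    filter_upwards [Iio_mem_nhds (lt_add_one t)] with x hx
    exact hA.duhamel_of_le hf.continuous h0 (le_of_lt hx)
  rw [hA.duhamel_of_le hf'.continuous (deriv_eq_zero_of_Iic hf h0) (lt_add_one t).le]
  refine HasDerivAt.congr_of_eventuallyEq ?_ heq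
  have hc : Continuous fun p : ℝ × ℝ => hA.sine p.2 (deriv f (p.1 - p.2)) :=
    (hA.continuous_sine.comp continuous_snd).clm_apply
      (hf'.continuous.comp (continuous_fst.sub continuous_snd))
  obtain ⟨M, hM⟩ := ((isCompact_Icc (a := t - 1) (b := t + 1)).prod
    (isCompact_uIcc (a := 0) (b := t + 1))).exists_bound_of_continuousOn hc.continuousOn
  refine (intervalIntegral.hasDerivAt_integral_of_dominated_loc_of_deriv_le
    (F' := fun x s => hA.sine s (deriv f (x - s))) (bound := fun _ => M)
    (Icc_mem_nhds (sub_one_lt t) (lt_add_one t)) ?_ ?_ ?_ ?_ ?_ ?_).2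
  · exact Eventually.of_forall fun x =>
      (hA.continuous_sine_apply hf.continuous x).aestronglyMeasurable
  · exact (hA.continuous_sine_apply hf.continuous t).intervalIntegrable _ _
  · exact (hA.continuous_sine_apply hf'.continuous t).aestronglyMeasurable
  · exact Eventually.of_forall fun s hs x hx => hM (x, s) ⟨hx, uIoc_subset_uIcc hs⟩
  · exact intervalIntegrable_const
  · exact Eventually.of_forall fun s _ x _ => hasDerivAt_clm _
      ((hasDerivAt_of_contDiff hf (x - s)).comp_sub_const x s)

theorem A1.deriv_duhamel (hA : A1 A) {f : ℝ → H} (hf : ContDiff ℝ ∞ f)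
    (h0 : ∀ t ≤ 0, f t = 0) : deriv (hA.duhamel f) = hA.duhamel (deriv f) :=
  funext fun t => (hA.hasDerivAt_duhamel hf h0 t).deriv

theorem A1.contDiff_duhamel (hA : A1 A) {f : ℝ → H} (hf : ContDiff ℝ ∞ f)
    (h0 : ∀ t ≤ 0, f t = 0) : ContDiff ℝ ∞ (hA.duhamel f) := by
  rw [contDiff_infty]
  intro n
  induction n generalizing f with
  | zero =>
    exact contDiff_zero.2 (continuous_iff_continuousAt.2 fun t =>
      (hA.hasDerivAt_duhamel hf h0 t).continuousAt)
  | succ n ih =>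
    push_cast
    rw [contDiff_succ_iff_deriv]
    refine ⟨fun t => (hA.hasDerivAt_duhamel hf h0 t).differentiableAt, by simp, ?_⟩
    rw [hA.deriv_duhamel hf h0]
    exact ih (contDiff_infty_iff_deriv.1 hf).2 (deriv_eq_zero_of_Iic hf h0)

theorem A1.eigenProj_duhamel (hA : A1 A) {f : ℝ → H} (hf : Continuous f) (μ t : ℝ) :
    eigenProj A μ (hA.duhamel f t) =
      ∫ s in (0 : ℝ)..t, (Real.sin (√μ * s) / √μ) • eigenProj A μ (f (t - s)) := by
  rw [A1.duhamel, ← ContinuousLinearMap.intervalIntegral_comp_comm _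
    ((hA.continuous_sine_apply hf t).intervalIntegrable _ _)]
  refine intervalIntegral.integral_congr fun s _ => ?_
  rw [hA.isMultiplier_sine, RCLike.real_smul_eq_coe_smul (K := 𝕜)]

/-- The wave equation with `A` inverted, which also yields membership in the domain. On each mode it
is two integrations by parts against `sin (r s) / r`, where `r = √μ`. -/
theorem A1.duhamel_eq_inv (hA : A1 A) {f : ℝ → H} (hf : ContDiff ℝ ∞ f)
    (h0 : ∀ t ≤ 0, f t = 0) (t : ℝ) :
    hA.duhamel f t = hA.inv (f t - deriv (deriv (hA.duhamel f)) t) := by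
  have hf' := (contDiff_infty_iff_deriv.1 hf).2
  have hf'' := (contDiff_infty_iff_deriv.1 hf').2
  have h0' := deriv_eq_zero_of_Iic hf h0
  rw [hA.deriv_duhamel hf h0, hA.deriv_duhamel hf' h0']
  refine hA.ext_eigenProj fun μ => ?_
  rcases le_or_gt μ 0 with h | h
  · rw [hA.eigenProj_eq_zero_of_nonpos h, hA.eigenProj_eq_zero_of_nonpos h]
  have h1 : (μ : 𝕜) ≠ 0 := by exact_mod_cast h.ne'
  refine smul_right_injective H h1 ?_
  simp only
  rw [hA.eigenProj_inv, map_sub, eq_sub_iff_add_eq, hA.eigenProj_duhamel hf.continuous,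
    hA.eigenProj_duhamel hf''.continuous, ← RCLike.real_smul_eq_coe_smul,
    ← intervalIntegral.integral_smul]
  set r := √μ with hr
  have hr0 : 0 < r := Real.sqrt_pos.2 h
  have hμ : μ = r * r := (Real.mul_self_sqrt h.le).symm
  set P := eigenProj A μ
  have hP : ∀ {g : ℝ → H}, Continuous g → Continuous fun s => P (g (t - s)) :=
    fun hg => P.continuous.comp (hg.comp (continuous_const.sub continuous_id))
  have c0 := hP hf.continuous
  have c1 := hP hf'.continuous
  have c2 := hP hf''.continuous
  have hd : ∀ {g : ℝ → H}, ContDiff ℝ ∞ g → ∀ s, HasDerivAt (fun s => P (g (t - s)))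
      (-P (deriv g (t - s))) s := by
    intro g hg s
    have := (hasDerivAt_of_contDiff hg (t - s)).scomp s ((hasDerivAt_id s).const_sub t)
    have := hasDerivAt_clm P this
    simpa using this
  rw [← intervalIntegral.integral_add (Continuous.intervalIntegrable (by fun_prop) _ _)
    (Continuous.intervalIntegrable (by fun_prop) _ _)]
  -- The primitive collects the boundary terms: at `s = t` they vanish because `f` and its
  -- derivative vanish at 0, and at `s = 0` only the projection of `f t` survives.
  rw [intervalIntegral.integral_eq_sub_of_hasDerivAt (f := fun s =>
    -(Real.cos (r * s) • P (f (t - s))) - (Real.sin (r * s) / r) • P (deriv f (t - s)))]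
  · simp [h0 0 le_rfl, h0' 0 le_rfl]
  · intro s _
    have e1 : HasDerivAt (fun s => Real.cos (r * s)) (-Real.sin (r * s) * (r * 1)) s :=
      ((hasDerivAt_id s).const_mul r).cos
    have e2 : HasDerivAt (fun s => Real.sin (r * s) / r) (Real.cos (r * s) * (r * 1) / r) s :=
      (((hasDerivAt_id s).const_mul r).sin).div_const r
    have := (e1.smul (hd hf s)).neg.sub (e2.smul (hd hf' s))
    refine this.congr_deriv ?_
    have h3 : Real.cos (r * s) * (r * 1) / r = Real.cos (r * s) := by field_simp
    have h4 : μ * (Real.sin (r * s) / r) = Real.sin (r * s) * r := by rw [hμ]; field_simp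
    rw [h3, smul_smul, h4]
    simp only [smul_neg, neg_mul, neg_smul, mul_one]
    abel
  · exact Continuous.intervalIntegrable (by fun_prop) _ _

/-- `z` is a smooth solution on the whole real line of `z'' + A z = f`, for a smooth `f`. -/
structure IsSmoothSol (hA : A1 A) (f z : ℝ → H) : Prop where
  source : ContDiff ℝ ∞ f
  smooth : ContDiff ℝ ∞ z
  equation : ∀ t, z t = hA.inv (f t - deriv (deriv z) t)

theorem A1.isSmoothSol_duhamel (hA : A1 A) {f : ℝ → H} (hf : ContDiff ℝ ∞ f)
    (h0 : ∀ t ≤ 0, f t = 0) : IsSmoothSol hA f (hA.duhamel f) :=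
  ⟨hf, hA.contDiff_duhamel hf h0, hA.duhamel_eq_inv hf h0⟩

namespace IsSmoothSol

variable {hA : A1 A} {f z : ℝ → H}

theorem zero : IsSmoothSol hA (fun _ => 0) (fun _ => 0) :=
  ⟨contDiff_const, contDiff_const, by simp⟩

theorem deriv (h : IsSmoothSol hA f z) : IsSmoothSol hA (deriv f) (deriv z) := by
  have hf := (contDiff_infty_iff_deriv.1 h.source).2
  have hz := (contDiff_infty_iff_deriv.1 h.smooth).2
  have hz' := (contDiff_infty_iff_deriv.1 hz).2
  refine ⟨hf, hz, fun t => ?_⟩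
  have h1 := hasDerivAt_clm hA.inv
    ((hasDerivAt_of_contDiff h.source t).sub (hasDerivAt_of_contDiff hz' t))
  have h2 : z = fun t => hA.inv (f t - _root_.deriv (_root_.deriv z) t) := funext h.equation
  conv_lhs => rw [h2]
  exact h1.deriv

theorem iteratedDeriv (h : IsSmoothSol hA f z) (k : ℕ) :
    IsSmoothSol hA (iteratedDeriv k f) (iteratedDeriv k z) := by
  induction k with
  | zero => simpa using h
  | succ k ih => rw [iteratedDeriv_succ, iteratedDeriv_succ]; exact ih.deriv

theorem comp_add_const (h : IsSmoothSol hA f z) (a : ℝ) :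
    IsSmoothSol hA (fun t => f (t + a)) (fun t => z (t + a)) := by
  refine ⟨h.source.comp (contDiff_id.add contDiff_const),
    h.smooth.comp (contDiff_id.add contDiff_const), fun t => ?_⟩
  have e : ∀ g : ℝ → H, _root_.deriv (fun t => g (t + a)) = fun t => _root_.deriv g (t + a) :=
    fun g => funext fun t => deriv_comp_add_const g a t
  rw [e, e]
  exact h.equation _

theorem mem_domain (h : IsSmoothSol hA f z) (t : ℝ) : z t ∈ A.domain := by
  rw [h.equation]; exact hA.inv_mem _

theorem map_eq (h : IsSmoothSol hA f z) (t : ℝ) (u : A.domain) (hu : (u : H) = z t) :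
    A u = f t - _root_.deriv (_root_.deriv z) t := by
  have : u = ⟨_, hA.inv_mem (f t - _root_.deriv (_root_.deriv z) t)⟩ :=
    Subtype.ext (hu.trans (h.equation t))
  rw [this, hA.map_inv]

theorem isStrongSol (h : IsSmoothSol hA f z) {T : ℝ} {g : ℝ → H}
    (hg : ∀ t ∈ Icc 0 T, g t = f t) :
    IsStrongSol A T g (fun t => ⟨z t, h.mem_domain t⟩) (_root_.deriv z) := by
  have hz := (contDiff_infty_iff_deriv.1 h.smooth).2
  have hz' := (contDiff_infty_iff_deriv.1 hz).2
  have hmap : ∀ t, A ⟨z t, h.mem_domain t⟩ = f t - _root_.deriv (_root_.deriv z) t :=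
    fun t => h.map_eq t _ rfl
  have hc : Continuous fun t => f t - _root_.deriv (_root_.deriv z) t :=
    h.source.continuous.sub hz'.continuous
  have hpow : ∀ t, z t ∈ powDom A (1 / 2) ∧ fracPow A (1 / 2) (z t) =
      hA.invSqrt (f t - _root_.deriv (_root_.deriv z) t) := fun t => by
    rw [h.equation t]; exact hA.fracPow_inv _
  refine ⟨⟨?_, fun t _ => (hpow t).1, ?_, hz.continuous.continuousOn, ?_, ?_⟩, ?_⟩
  · have hm : MemLp f 2 (volume.restrict (Icc 0 T)) :=
      memLp_of_continuousOn_Icc h.source.continuous.continuousOn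
    refine hm.ae_eq ?_
    refine (ae_restrict_iff' measurableSet_Icc).2 (Eventually.of_forall fun t ht => (hg t ht).symm)
  · simp only [fun t => (hpow t).2]
    exact (hA.invSqrt.continuous.comp hc).continuousOn
  · intro φ t _
    have h1 : ∀ s ∈ uIcc 0 t, HasDerivAt (fun s => inner 𝕜 φ (z s)) (inner 𝕜 φ (_root_.deriv z s)) s :=
      fun s _ => by simpa using (hasDerivAt_const s φ).inner 𝕜 (hasDerivAt_of_contDiff h.smooth s)
    rw [intervalIntegral.integral_eq_sub_of_hasDerivAt h1]
    · simp
    · exact (continuous_const.inner hz.continuous).intervalIntegrable _ _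
  · intro φ t ht
    have h1 : ∀ s ∈ uIcc 0 t, HasDerivAt (fun s => inner 𝕜 (φ : H) (_root_.deriv z s))
        (inner 𝕜 (φ : H) (f s) - inner 𝕜 (A φ) (z s)) s := fun s _ => by
      have := (hasDerivAt_const s (φ : H)).inner 𝕜 (hasDerivAt_of_contDiff hz s)
      refine this.congr_deriv ?_
      have h2 := hA.inner_map_left φ ⟨z s, h.mem_domain s⟩
      rw [hmap, inner_sub_right] at h2
      rw [h2]; simp
    have i1 : Continuous fun s => inner 𝕜 (φ : H) (f s) := continuous_const.inner h.source.continuous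
    have i2 : Continuous fun s => inner 𝕜 (A φ) (z s) := continuous_const.inner h.smooth.continuous
    have h3 := intervalIntegral.integral_eq_sub_of_hasDerivAt h1 ((i1.sub i2).intervalIntegrable _ _)
    rw [intervalIntegral.integral_sub (i1.intervalIntegrable _ _) (i2.intervalIntegrable _ _)] at h3
    have h4 : ∫ s in (0 : ℝ)..t, inner 𝕜 (φ : H) (g s) = ∫ s in (0 : ℝ)..t, inner 𝕜 (φ : H) (f s) := by
      refine intervalIntegral.integral_congr fun s hs => ?_
      rw [uIcc_of_le ht.1] at hs
      rw [hg s ⟨hs.1, hs.2.trans ht.2⟩]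
    rw [h4, sub_add_eq_add_sub, add_sub_assoc, h3]
    abel
  · simp only [hmap]
    exact hc.continuousOn

theorem hasDerivAt_energy (h : IsSmoothSol hA f z) (t : ℝ) :
    HasDerivAt (fun t => energy A 1 (z t) (_root_.deriv z t))
      (RCLike.re (inner 𝕜 (_root_.deriv z t) (f t))) t := by
  have hz := (contDiff_infty_iff_deriv.1 h.smooth).2
  have hz' := (contDiff_infty_iff_deriv.1 hz).2
  -- `a` is `A z`. The potential energy becomes the pairing of `a` with `z`, differentiable in `H`,
  -- and symmetry of `A⁻¹` identifies the two terms of its derivative up to conjugation.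
  set a : ℝ → H := fun t => f t - _root_.deriv (_root_.deriv z) t with ha
  have hac : ContDiff ℝ ∞ a := h.source.sub hz'
  have hza : ∀ t, z t = hA.inv (a t) := h.equation
  have hza' : _root_.deriv z t = hA.inv (_root_.deriv a t) := by
    have := (hasDerivAt_clm hA.inv (hasDerivAt_of_contDiff hac t)).deriv
    rw [← this]
    congr 1
    exact funext hza
  have hE : (fun t => energy A 1 (z t) (_root_.deriv z t)) = fun t =>
      (RCLike.re (inner 𝕜 (a t) (z t)) +
        RCLike.re (inner 𝕜 (_root_.deriv z t) (_root_.deriv z t))) / 2 := by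
    funext s
    rw [hA.energy_one, inner_self_eq_norm_sq, hza s, hA.norm_fracPow_inv_sq]
  rw [hE]
  have d1 := (hasDerivAt_of_contDiff hac t).inner 𝕜 (hasDerivAt_of_contDiff h.smooth t)
  have d2 := (hasDerivAt_of_contDiff hz t).inner 𝕜 (hasDerivAt_of_contDiff hz t)
  have d1' := (RCLike.reCLM (K := 𝕜)).hasFDerivAt.comp_hasDerivAt t d1
  have d2' := (RCLike.reCLM (K := 𝕜)).hasFDerivAt.comp_hasDerivAt t d2
  refine ((d1'.add d2').div_const 2).congr_deriv ?_
  have e1 : inner 𝕜 (_root_.deriv a t) (z t) = inner 𝕜 (_root_.deriv z t) (a t) := by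
    rw [hza t, ← hA.inner_inv_left, ← hza']
  have e2 : f t = a t + _root_.deriv (_root_.deriv z) t := by simp [ha]
  rw [e1, e2, inner_add_right]
  simp only [map_add, RCLike.reCLM_apply]
  rw [inner_re_symm (a t), inner_re_symm (_root_.deriv (_root_.deriv z) t)]
  ring

theorem energy_eq (h : IsSmoothSol hA (fun _ => 0) z) (s t : ℝ) :
    energy A 1 (z s) (_root_.deriv z s) = energy A 1 (z t) (_root_.deriv z t) :=
  is_const_of_deriv_eq_zero (f := fun t => energy A 1 (z t) (_root_.deriv z t))
    (fun t => (h.hasDerivAt_energy t).differentiableAt)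
    (fun t => by rw [(h.hasDerivAt_energy t).deriv]; simp) s t

theorem energy_le (h : IsSmoothSol hA f z) (h0 : z 0 = 0) (h0' : _root_.deriv z 0 = 0) {t : ℝ}
    (ht : 0 ≤ t) : energy A 1 (z t) (_root_.deriv z t) ≤
      Real.exp t / 2 * ∫ s in (0 : ℝ)..t, ‖f s‖ ^ 2 := by
  set E := fun t => energy A 1 (z t) (_root_.deriv z t)
  have hfc : Continuous fun s => ‖f s‖ ^ 2 := h.source.continuous.norm.pow 2
  -- Grönwall's argument: `g` is nonincreasing because `E' ≤ E + ‖f‖² / 2`, and `g 0 = 0`.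
  let g : ℝ → ℝ := fun t => Real.exp (-t) * E t - (∫ s in (0 : ℝ)..t, ‖f s‖ ^ 2) / 2
  have hg : ∀ t, HasDerivAt g (Real.exp (-t) * (-1) * E t +
      Real.exp (-t) * (RCLike.re (inner 𝕜 (_root_.deriv z t) (f t))) - ‖f t‖ ^ 2 / 2) t := fun t =>
    (((hasDerivAt_neg t).exp).mul (h.hasDerivAt_energy t)).sub
      ((hfc.integral_hasStrictDerivAt 0 t).hasDerivAt.div_const 2)
  have hanti : AntitoneOn g (Ici 0) := by
    refine antitoneOn_of_deriv_nonpos (convex_Ici 0)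
      (fun t _ => (hg t).continuousAt.continuousWithinAt)
      (fun t _ => (hg t).differentiableAt.differentiableWithinAt) fun t ht => ?_
    rw [interior_Ici] at ht
    rw [(hg t).deriv]
    have h1 : RCLike.re (inner 𝕜 (_root_.deriv z t) (f t)) ≤ ‖_root_.deriv z t‖ * ‖f t‖ :=
      re_inner_le_norm _ _
    have h2 : ‖_root_.deriv z t‖ ^ 2 / 2 ≤ E t := by
      simp only [E]
      rw [hA.energy_one]
      nlinarith [sq_nonneg ‖fracPow A (1 / 2) (z t)‖]
    have h3 : Real.exp (-t) ≤ 1 := Real.exp_le_one_iff.2 (by linarith [show 0 < t from ht])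
    have h4 := Real.exp_pos (-t)
    have h5 : RCLike.re (inner 𝕜 (_root_.deriv z t) (f t)) - E t ≤ ‖f t‖ ^ 2 / 2 := by
      nlinarith [sq_nonneg (‖_root_.deriv z t‖ - ‖f t‖)]
    nlinarith [mul_le_mul_of_nonneg_left h5 h4.le, sq_nonneg ‖f t‖]
  have h1 := hanti self_mem_Ici ht ht
  have h2 : g 0 = 0 := by
    simp [g, E, h0, h0', energy, fracPow_zero_right]
  rw [h2] at h1
  have h3 : Real.exp (-t) * E t ≤ (∫ s in (0 : ℝ)..t, ‖f s‖ ^ 2) / 2 := by simpa [g] using h1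
  calc E t = Real.exp t * (Real.exp (-t) * E t) := by
        rw [← mul_assoc, ← Real.exp_add]; simp
    _ ≤ Real.exp t * ((∫ s in (0 : ℝ)..t, ‖f s‖ ^ 2) / 2) := by gcongr
    _ = _ := by ring

end IsSmoothSol

end Wave

/-! ### From observability of the cascade to observability through one coupling. -/

section Observability

set_option linter.unusedSectionVars false

open scoped ContDiff

variable {𝕜 : Type*} [RCLike 𝕜] {H : Type*} [NormedAddCommGroup H] [InnerProductSpace 𝕜 H]
  [CompleteSpace H] {A : H →ₗ.[𝕜] H} {G : Type*} [NormedAddCommGroup G] [InnerProductSpace 𝕜 G]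
  {B : A.domain × H →ₗ[𝕜] G}

/-- The observation of a strong solution is obtained by applying the observation operator. -/
theorem IsStrongSol.isObservation (hB : A4 A B) {T : ℝ} {f : ℝ → H} {w : ℝ → A.domain}
    {w' : ℝ → H} (h : IsStrongSol A T f w w') :
    IsObservation A B T f (fun t => (w t : H)) w' (fun t => B (w t, w' t)) := by
  obtain ⟨⟨M, hM⟩, -⟩ := hB
  refine ⟨memLp_of_continuousOn_Icc fun t ht => ?_, fun _ => f, fun _ => w, fun _ => w',
    fun _ => h, ?_, ?_, ?_, ?_⟩
  · have h1 : Tendsto (fun s => M * (‖A (w s) - A (w t)‖ + ‖w' s - w' t‖)) (𝓝[Icc 0 T] t)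
        (𝓝 (M * (‖A (w t) - A (w t)‖ + ‖w' t - w' t‖))) :=
      tendsto_const_nhds.mul (((h.2 t ht).sub tendsto_const_nhds).norm.add
        ((h.1.cont' t ht).sub tendsto_const_nhds).norm)
    simp only [sub_self, norm_zero, add_zero, mul_zero] at h1
    refine tendsto_iff_norm_sub_tendsto_zero.2 (squeeze_zero (fun _ => norm_nonneg _) (fun s => ?_) h1)
    rw [← map_sub, Prod.mk_sub_mk, ← A.map_sub]
    exact hM _ _
  · exact fun _ hu => Eventually.of_forall fun _ _ _ => refl_mem_uniformity hu
  · exact fun _ hu => Eventually.of_forall fun _ _ _ => refl_mem_uniformity hu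
  · simp
  · simp

variable [NormedSpace ℝ H] [IsScalarTower ℝ 𝕜 H]

theorem A1.isSmoothSol_iteratedDeriv (hA : A1 A) {w : ℝ → H}
    (h : IsSmoothSol hA (fun _ => 0) w) (k : ℕ) :
    IsSmoothSol hA (fun _ => 0) (iteratedDeriv k w) := by
  induction k with
  | zero => simpa using h
  | succ k ih => rw [iteratedDeriv_succ]; simpa using ih.deriv

/-- Each time derivative turns the data `(w, w')` into `(w', -A w)`, which lowers the level by one
without changing the energy. -/
theorem A1.energy_iteratedDeriv (hA : A1 A) {w : ℝ → H}
    (h : IsSmoothSol hA (fun _ => 0) w) (k : ℕ) (t : ℝ) :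
    energy A (1 - k) (iteratedDeriv k w t) (iteratedDeriv (k + 1) w t) =
      energy A 1 (w t) (deriv w t) := by
  induction k with
  | zero => simp
  | succ k ih =>
    have hk := hA.isSmoothSol_iteratedDeriv h k
    have e := hk.map_eq t ⟨_, hk.mem_domain t⟩ rfl
    rw [← ih, ← hA.energy_shift _ ⟨_, hk.mem_domain t⟩, e, iteratedDeriv_succ (n := k + 1),
      iteratedDeriv_succ (n := k)]
    push_cast
    simp

/-- The sources of the components `i + k` of a cascade which is driven from rest by `X`; each
component is driven by the velocity of the preceding one. -/
def A1.stageSource (hA : A1 A) (C : ℕ → H →L[𝕜] H) (i : ℕ) (X : ℝ → H) : ℕ → ℝ → H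
  | 0 => fun t => -C i (X t)
  | k + 1 => fun t => -C (i + k + 1) (deriv (hA.duhamel (hA.stageSource C i X k)) t)

theorem A1.stageSource_smooth (hA : A1 A) (C : ℕ → H →L[𝕜] H) (i : ℕ) {X : ℝ → H}
    (hX : ContDiff ℝ ∞ X) (h0 : ∀ t ≤ 0, X t = 0) (k : ℕ) :
    ContDiff ℝ ∞ (hA.stageSource C i X k) ∧ ∀ t ≤ 0, hA.stageSource C i X k t = 0 := by
  induction k with
  | zero => exact ⟨(contDiff_clm _ hX).neg, fun t ht => by simp [stageSource, h0 t ht]⟩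
  | succ k ih =>
    have h := hA.contDiff_duhamel ih.1 ih.2
    refine ⟨(contDiff_clm _ (contDiff_infty_iff_deriv.1 h).2).neg, fun t ht => ?_⟩
    simp [stageSource,
      deriv_eq_zero_of_Iic h (hA.duhamel_eq_zero ih.1.continuous ih.2) t ht]

theorem integral_norm_sq_mono {E : Type*} [NormedAddCommGroup E] {f : ℝ → E} (hf : Continuous f)
    {a b c d : ℝ} (hca : c ≤ a) (hab : a ≤ b) (hbd : b ≤ d) :
    ∫ s in a..b, ‖f s‖ ^ 2 ≤ ∫ s in c..d, ‖f s‖ ^ 2 :=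
  intervalIntegral.integral_mono_interval hca hab hbd (Eventually.of_forall fun _ => sq_nonneg _)
    ((hf.norm.pow 2).intervalIntegrable _ _)

theorem A1.energy_duhamel_le (hA : A1 A) {f : ℝ → H} (hf : ContDiff ℝ ∞ f)
    (h0 : ∀ t ≤ 0, f t = 0) {t T : ℝ} (ht : t ∈ Icc 0 T) :
    energy A 1 (hA.duhamel f t) (deriv (hA.duhamel f) t) ≤
      Real.exp T / 2 * ∫ s in (0 : ℝ)..T, ‖f s‖ ^ 2 := by
  have hz := hA.duhamel_eq_zero hf.continuous h0
  have h := hA.isSmoothSol_duhamel hf h0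
  refine (h.energy_le (hz 0 le_rfl) (deriv_eq_zero_of_Iic h.smooth hz 0 le_rfl) ht.1).trans ?_
  refine mul_le_mul (by gcongr; exact ht.2) (integral_norm_sq_mono hf.continuous le_rfl ht.1 ht.2)
    ?_ (by positivity)
  exact intervalIntegral.integral_nonneg ht.1 fun _ _ => sq_nonneg _

/-- The energy estimate from rest bounds each velocity uniformly on `[0, T]` by the preceding source
in `L²`. Since the stages are coupled through velocities, no regularity is lost along the chain. -/
theorem A1.stageSource_le (hA : A1 A) (C : ℕ → H →L[𝕜] H) (i : ℕ) {T : ℝ} (hT : 0 ≤ T) (k : ℕ) :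
    ∃ M : ℝ, 0 ≤ M ∧ ∀ X : ℝ → H, ContDiff ℝ ∞ X → (∀ t ≤ 0, X t = 0) →
      ∫ t in (0 : ℝ)..T, ‖hA.stageSource C i X k t‖ ^ 2 ≤
        M * ∫ t in (0 : ℝ)..T, ‖C i (X t)‖ ^ 2 := by
  induction k with
  | zero => exact ⟨1, zero_le_one, fun X _ _ => by simp [stageSource]⟩
  | succ k ih =>
    obtain ⟨M, hM, ih⟩ := ih
    refine ⟨T * (‖C (i + k + 1)‖ ^ 2 * (Real.exp T * M)), by positivity, fun X hX h0 => ?_⟩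
    obtain ⟨hs, hs0⟩ := hA.stageSource_smooth C i hX h0 k
    have hs' := (hA.stageSource_smooth C i hX h0 (k + 1)).1.continuous
    set I := ∫ t in (0 : ℝ)..T, ‖C i (X t)‖ ^ 2
    set z := hA.duhamel (hA.stageSource C i X k) with hz
    have hb : ∀ t ∈ Icc 0 T, ‖hA.stageSource C i X (k + 1) t‖ ^ 2 ≤
        ‖C (i + k + 1)‖ ^ 2 * (Real.exp T * M) * I := by
      intro t ht
      have h1 := hA.energy_duhamel_le hs hs0 ht
      have h2 : ‖deriv z t‖ ^ 2 ≤ 2 * energy A 1 (z t) (deriv z t) := by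
        rw [hA.energy_one]
        nlinarith [sq_nonneg ‖fracPow A (1 / 2) (z t)‖]
      have h3 : ‖deriv z t‖ ^ 2 ≤ Real.exp T * M * I := by
        have := mul_le_mul_of_nonneg_left (ih X hX h0) (Real.exp_pos T).le
        nlinarith
      calc ‖hA.stageSource C i X (k + 1) t‖ ^ 2 = ‖C (i + k + 1) (deriv z t)‖ ^ 2 := by
            simp [stageSource, z]
        _ ≤ (‖C (i + k + 1)‖ * ‖deriv z t‖) ^ 2 := by
            gcongr; exact ContinuousLinearMap.le_opNorm _ _
        _ = ‖C (i + k + 1)‖ ^ 2 * ‖deriv z t‖ ^ 2 := by ring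
        _ ≤ ‖C (i + k + 1)‖ ^ 2 * (Real.exp T * M * I) := by gcongr
        _ = _ := by ring
    calc ∫ t in (0 : ℝ)..T, ‖hA.stageSource C i X (k + 1) t‖ ^ 2
        ≤ ∫ _ in (0 : ℝ)..T, ‖C (i + k + 1)‖ ^ 2 * (Real.exp T * M) * I :=
          intervalIntegral.integral_mono_on hT ((hs'.norm.pow 2).intervalIntegrable _ _)
            intervalIntegrable_const hb
      _ = _ := by rw [intervalIntegral.integral_const, smul_eq_mul, sub_zero]; ring

/-- The observation of a solution at rest at time `0`, on a later time interval. -/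
theorem A4.integral_le (hB : A4 A B) (hA : A1 A) {T : ℝ} (hT : 0 < T) :
    ∃ D : ℝ, 0 < D ∧ ∀ f : ℝ → H, ContDiff ℝ ∞ f → (∀ t ≤ 0, f t = 0) →
      ∀ w : ℝ → A.domain, (∀ t, (w t : H) = hA.duhamel f (t + 1)) →
      ∫ t in (0 : ℝ)..T, ‖B (w t, deriv (fun s => hA.duhamel f (s + 1)) t)‖ ^ 2 ≤
        D * ∫ t in (0 : ℝ)..(T + 1), ‖f t‖ ^ 2 := by
  obtain ⟨D, hD, h⟩ := hB.2 T hT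
  -- In `2 + T`, the 2 counts the energies at the two endpoints and `T` the integrated energy; the
  -- final 1 is for the source.
  refine ⟨D * (Real.exp (T + 1) / 2 * (2 + T) + 1), by positivity, fun f hf h0 w hw => ?_⟩
  have hsol := (hA.isSmoothSol_duhamel hf h0).comp_add_const 1
  have hst := hsol.isStrongSol (T := T) (fun _ _ => rfl)
  obtain rfl : w = fun t => ⟨_, hsol.mem_domain t⟩ := funext fun t => Subtype.ext (hw t)
  have hle := h _ _ _ hst
  have hd : deriv (fun s => hA.duhamel f (s + 1)) = fun s => deriv (hA.duhamel f) (s + 1) :=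
    funext fun t => deriv_comp_add_const _ _ _
  refine hle.trans ?_
  simp only [hd]
  set I := ∫ t in (0 : ℝ)..(T + 1), ‖f t‖ ^ 2
  have hE : ∀ t ∈ Icc 0 T, energy A 1 (hA.duhamel f (t + 1)) (deriv (hA.duhamel f) (t + 1)) ≤
      Real.exp (T + 1) / 2 * I := fun t ht =>
    hA.energy_duhamel_le hf h0 ⟨by linarith [ht.1], by linarith [ht.2]⟩
  have hEc : Continuous fun t =>
      energy A 1 (hA.duhamel f (t + 1)) (deriv (hA.duhamel f) (t + 1)) := by
    have : Continuous fun t => energy A 1 (hA.duhamel f t) (deriv (hA.duhamel f) t) :=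
      continuous_iff_continuousAt.2 fun t =>
        ((hA.isSmoothSol_duhamel hf h0).hasDerivAt_energy t).continuousAt
    exact this.comp (continuous_id.add continuous_const)
  have h1 := hE 0 ⟨le_rfl, hT.le⟩
  have h2 := hE T ⟨hT.le, le_rfl⟩
  have h3 : ∫ t in (0 : ℝ)..T, energy A 1 (hA.duhamel f (t + 1)) (deriv (hA.duhamel f) (t + 1)) ≤
      T * (Real.exp (T + 1) / 2 * I) := by
    calc _ ≤ ∫ _ in (0 : ℝ)..T, Real.exp (T + 1) / 2 * I :=
          intervalIntegral.integral_mono_on hT.le (hEc.intervalIntegrable _ _)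
            intervalIntegrable_const hE
      _ = _ := by rw [intervalIntegral.integral_const, smul_eq_mul, sub_zero]
  have h4 : ∫ t in (0 : ℝ)..T, ‖f (t + 1)‖ ^ 2 ≤ I := by
    rw [intervalIntegral.integral_comp_add_right (fun t => ‖f t‖ ^ 2)]
    exact integral_norm_sq_mono hf.continuous (by norm_num) (by linarith) le_rfl
  rw [mul_assoc D]
  refine mul_le_mul_of_nonneg_left ?_ hD.le
  linarith

/-- The observability of the cascade implies an observability inequality for the coupling
operators, for smooth solutions of the free equation. -/
theorem OBS.exists_energy_le (hA : A1 A) (hB : A4 A B) {C : ℕ → H →L[𝕜] H} {n i : ℕ}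
    (hi : i ∈ Finset.Icc 2 n) {T : ℝ} (hT : 0 < T) (h : OBS A C n B T) :
    ∃ M : ℝ, 0 < M ∧ ∀ w : ℝ → H, IsSmoothSol hA (fun _ => 0) w →
      energy A 1 (w 0) (deriv w 0) ≤ M * ∫ t in (0 : ℝ)..(T + 1), ‖C i (deriv w t)‖ ^ 2 := by
  obtain ⟨hi2, hin⟩ := Finset.mem_Icc.1 hi
  obtain ⟨c, hc, hobs⟩ := h
  obtain ⟨D, hD, hDle⟩ := hB.integral_le hA hT
  obtain ⟨M, hM, hMle⟩ := hA.stageSource_le C i (T := T + 1) (by linarith) (n - i)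
  -- The added 1 keeps the constant positive when `M = 0`.
  refine ⟨(D * M + 1) / c, by positivity, fun w hw => ?_⟩
  have hw' := (contDiff_infty_iff_deriv.1 hw.smooth).2
  -- The factor 2 completes the transition at `1 / 2`, so that `χ = 1` on a whole neighbourhood of
  -- every `t ≥ 1`, as needed for derivatives at `t = 1`.
  let χ : ℝ → ℝ := fun t => Real.smoothTransition (2 * t)
  let X : ℝ → H := fun t => χ t • deriv w t
  have hχ : ContDiff ℝ ∞ χ := Real.smoothTransition.contDiff.comp (contDiff_const.mul contDiff_id)
  have hX : ContDiff ℝ ∞ X := hχ.smul hw'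
  have hX0 : ∀ t ≤ 0, X t = 0 := fun t ht => by
    simp [X, χ, Real.smoothTransition.zero_of_nonpos (show 2 * t ≤ 0 by linarith)]
  have hsrc := hA.stageSource_smooth C i hX hX0
  let V : ℕ → ℝ → H := fun j => if j + 1 < i then fun _ => 0 else
    if j + 1 = i then w else hA.duhamel (hA.stageSource C i X (j - i))
  let F : ℕ → ℝ → H := fun j => if j < i then fun _ => 0 else hA.stageSource C i X (j - i)
  have hV : ∀ j, IsSmoothSol hA (F j) (V j) := by
    intro j
    by_cases h1 : j < i
    · by_cases h2 : j + 1 < i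
      · simp only [V, F, h1, h2, if_true]; exact IsSmoothSol.zero
      · have h3 : j + 1 = i := by omega
        simp only [V, F, if_pos h1, if_neg h2, if_pos h3]; exact hw
    · simp only [V, F, h1, show ¬ j + 1 < i by omega, show ¬ j + 1 = i by omega, if_false]
      exact hA.isSmoothSol_duhamel (hsrc _).1 (hsrc _).2
  have hF : ∀ j, 2 ≤ j → ∀ t, 1 ≤ t → F j =ᶠ[𝓝 t] fun s => -C j (deriv (V (j - 1)) s) := by
    intro j hj t ht
    rcases lt_trichotomy j i with h1 | h1 | h1
    · refine Eventually.of_forall fun s => ?_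
      simp [F, V, h1, show j - 1 + 1 < i by omega]
    · subst h1
      filter_upwards [Ioi_mem_nhds (show (1 / 2 : ℝ) < t by linarith)] with s hs
      have hs' : χ s = 1 := Real.smoothTransition.one_of_one_le (by linarith [show 1 / 2 < s from hs])
      simp [F, V, A1.stageSource, X, hs', show j - 1 + 1 = j by omega]
    · obtain ⟨k, rfl⟩ : ∃ k, j = i + k + 1 := ⟨j - i - 1, by omega⟩
      refine Eventually.of_forall fun s => ?_
      simp [F, V, A1.stageSource, show i + k + 1 - i = k + 1 by omega,
        show ¬ i + k + 1 < i by omega, show ¬ i + k + 1 = i by omega]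
  -- The decreasing order of differentiation turns coupling through velocities into coupling through
  -- positions; the shift by 1 starts the cascade after the cutoff has become 1.
  let u : ℕ → ℝ → H := fun j t => iteratedDeriv (n - j) (V j) (t + 1)
  have hu : ∀ j, IsSmoothSol hA (fun t => iteratedDeriv (n - j) (F j) (t + 1)) (u j) :=
    fun j => ((hV j).iteratedDeriv (n - j)).comp_add_const 1
  have hsource : ∀ j ∈ Finset.Icc 2 n, ∀ t ∈ Icc 0 T,
      -C j (u (j - 1) t) = iteratedDeriv (n - j) (F j) (t + 1) := by
    intro j hj t ht
    obtain ⟨hj2, hjn⟩ := Finset.mem_Icc.1 hj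
    rw [(hF j hj2 (t + 1) (by linarith [ht.1])).iteratedDeriv_eq]
    have := iteratedDeriv_clm (-C j) (contDiff_infty_iff_deriv.1 (hV (j - 1)).smooth).2 (n - j)
    rw [← iteratedDeriv_succ', show n - j + 1 = n - (j - 1) by omega] at this
    exact (congrFun this (t + 1)).symm
  have hcas : IsCascadeSol A C n T u fun j => deriv (u j) := by
    refine ⟨((hu 1).isStrongSol fun t ht => ?_).1, fun j hj => ((hu j).isStrongSol (hsource j hj)).1⟩
    simp [F, show 1 < i by omega]
  have hn : n ∈ Finset.Icc 2 n := Finset.mem_Icc.2 ⟨hi2.trans hin, le_rfl⟩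
  have hstrong := (hu n).isStrongSol (hsource n hn)
  have h1 := hobs u _ _ hcas (hstrong.isObservation hB)
  have hun : ∀ t, u n t = hA.duhamel (hA.stageSource C i X (n - i)) (t + 1) := fun t => by
    simp [u, V, show ¬ n + 1 < i by omega, show ¬ n + 1 = i by omega]
  have h2 := hDle _ (hsrc (n - i)).1 (hsrc (n - i)).2 (fun t => ⟨u n t, (hu n).mem_domain t⟩) hun
  rw [← funext hun] at h2
  have h3 := hMle X hX hX0
  have h4 : ∫ t in (0 : ℝ)..(T + 1), ‖C i (X t)‖ ^ 2 ≤
      ∫ t in (0 : ℝ)..(T + 1), ‖C i (deriv w t)‖ ^ 2 := by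
    refine intervalIntegral.integral_mono_on (by linarith)
      (((contDiff_clm _ hX).continuous.norm.pow 2).intervalIntegrable _ _)
      (((contDiff_clm _ hw').continuous.norm.pow 2).intervalIntegrable _ _) fun t _ => ?_
    have : C i (X t) = χ t • C i (deriv w t) := (C i).map_smul_of_tower _ _
    rw [this, norm_smul, Real.norm_of_nonneg (Real.smoothTransition.nonneg _)]
    refine pow_le_pow_left₀ (mul_nonneg (Real.smoothTransition.nonneg _) (norm_nonneg _)) ?_ 2
    exact mul_le_of_le_one_left (norm_nonneg _) (Real.smoothTransition.le_one _)
  have h5 : energy A 1 (w 0) (deriv w 0) ≤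
      ∑ j ∈ Finset.Icc 1 n, energy A (1 + (j : ℤ) - n) (u j 0) (deriv (u j) 0) := by
    -- Only the term of index `i - 1` is kept: its level is `1 - (n - (i - 1))`, and `u (i - 1)` is
    -- the derivative of `w` of order `n - (i - 1)`. Energy conservation moves time 1 back to time
    -- 0.
    have hmem : i - 1 ∈ Finset.Icc 1 n := Finset.mem_Icc.2 ⟨by omega, by omega⟩
    refine le_trans (le_of_eq ?_) (Finset.single_le_sum
      (f := fun j : ℕ => energy A (1 + (j : ℤ) - n) (u j 0) (deriv (u j) 0))
      (fun j _ => energy_nonneg _ _ _) hmem)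
    have hui : u (i - 1) = fun t => iteratedDeriv (n - (i - 1)) w (t + 1) := by
      simp [u, V, show i - 1 + 1 = i by omega]
    have hdu : deriv (u (i - 1)) 0 = iteratedDeriv (n - (i - 1) + 1) w 1 := by
      rw [hui, deriv_comp_add_const, iteratedDeriv_succ, zero_add]
    rw [hdu, hui, hw.energy_eq 0 1, ← hA.energy_iteratedDeriv hw (n - (i - 1)) 1]
    simp only [zero_add]
    congr 1
    omega
  set I := ∫ t in (0 : ℝ)..(T + 1), ‖C i (deriv w t)‖ ^ 2
  have hI : 0 ≤ I := intervalIntegral.integral_nonneg (by linarith) fun _ _ => sq_nonneg _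
  rw [div_mul_eq_mul_div, le_div_iff₀ hc]
  have h6 := mul_le_mul_of_nonneg_left h5 hc.le
  have h7 := mul_le_mul_of_nonneg_left (h3.trans (mul_le_mul_of_nonneg_left h4 hM)) hD.le
  have h8 := h6.trans (h1.trans (h2.trans h7))
  linarith

end Observability

/-! ### Extension from smooth to finite energy free solutions. -/

section Density

set_option linter.unusedSectionVars false

open scoped ContDiff

variable {𝕜 : Type*} [RCLike 𝕜] {H : Type*} [NormedAddCommGroup H] [InnerProductSpace 𝕜 H]
  [CompleteSpace H] {A : H →ₗ.[𝕜] H}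

theorem A1.norm_sq_le_of_eigenProj (hA : A1 A) {x a b : H}
    (h : ∀ μ, ‖eigenProj A μ x‖ ≤ ‖eigenProj A μ a‖ + ‖eigenProj A μ b‖) :
    ‖x‖ ^ 2 ≤ 2 * ‖a‖ ^ 2 + 2 * ‖b‖ ^ 2 := by
  refine hasSum_le (fun μ => ?_) (hA.hasSum_norm_eigenProj_sq x)
    (((hA.hasSum_norm_eigenProj_sq a).mul_left 2).add
      ((hA.hasSum_norm_eigenProj_sq b).mul_left 2))
  have := pow_le_pow_left₀ (norm_nonneg _) (h μ) 2
  nlinarith [sq_nonneg (‖eigenProj A μ a‖ - ‖eigenProj A μ b‖)]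

theorem A1.eigenProj_sum (hA : A1 A) (F : Finset ℝ) (μ : ℝ) (x : H) :
    eigenProj A μ (∑ ν ∈ F, eigenProj A ν x) = if μ ∈ F then eigenProj A μ x else 0 := by
  rw [map_sum]
  simp only [hA.eigenProj_comp]
  rw [Finset.sum_ite_eq]

variable [NormedSpace ℝ H] [IsScalarTower ℝ 𝕜 H]

/-- The modes of a free solution. -/
theorem IsSol.eigenProj_velocity (hA : A1 A) {T : ℝ} {w w' : ℝ → H}
    (h : IsSol A T (fun _ => 0) w w') {t : ℝ} (ht : t ∈ Icc 0 T) (μ : ℝ) :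
    eigenProj A μ (w' t) = Real.cos (√μ * t) • eigenProj A μ (w' 0) -
      Real.sin (√μ * t) • eigenProj A μ (fracPow A (1 / 2) (w 0)) := by
  rcases le_or_gt μ 0 with hμ | hμ
  · simp [hA.eigenProj_eq_zero_of_nonpos hμ]
  have hT : (0 : ℝ) ≤ T := ht.1.trans ht.2
  have h00 : (0 : ℝ) ∈ Icc 0 T := ⟨le_rfl, hT⟩
  set r := √μ with hr
  have hrr : μ = r * r := (Real.mul_self_sqrt hμ.le).symm
  have hy : eigenProj A μ (fracPow A (1 / 2) (w 0)) = r • eigenProj A μ (w 0) := by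
    rw [hA.eigenProj_fracPow (h.mem 0 h00), hr, Real.sqrt_eq_rpow,
      RCLike.real_smul_eq_coe_smul (K := 𝕜)]
  rw [hy]
  set P := eigenProj A μ with hP
  have hwc : ContinuousOn w (Icc 0 T) := by
    refine (hA.invSqrt.continuous.comp_continuousOn h.cont).congr fun s hs => ?_
    exact (hA.invSqrt_fracPow (h.mem s hs)).symm
  -- Continuous extension to the real line provides two-sided derivatives of the integrals, even at
  -- the endpoints of `[0, T]`.
  obtain ⟨g, hgc, hg⟩ : ∃ g : ℝ → H, Continuous g ∧ ∀ s ∈ Icc 0 T, g s = w' s :=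
    ⟨IccExtend hT ((Icc 0 T).domRestrict w'), h.cont'.domRestrict.Icc_extend',
      fun s hs => IccExtend_of_mem hT _ hs⟩
  obtain ⟨k, hkc, hk⟩ : ∃ k : ℝ → H, Continuous k ∧ ∀ s ∈ Icc 0 T, k s = w s :=
    ⟨IccExtend hT ((Icc 0 T).domRestrict w), hwc.domRestrict.Icc_extend',
      fun s hs => IccExtend_of_mem hT _ hs⟩
  have hPg : Continuous fun s => P (g s) := P.continuous.comp hgc
  have hPk : Continuous fun s => P (k s) := P.continuous.comp hkc
  -- On `[0, T]`, `p` and `q` are the projected position and velocity. Testing the weak equations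
  -- against eigenvectors gives `p' = q` and `q' = -μ p`.
  let p : ℝ → H := fun t => P (w 0) + ∫ s in (0 : ℝ)..t, P (g s)
  let q : ℝ → H := fun t => P (w' 0) - μ • ∫ s in (0 : ℝ)..t, P (k s)
  have hp : ∀ s ∈ Icc 0 T, P (w s) = p s := by
    intro s hs
    refine ext_inner_left 𝕜 fun φ => ?_
    have h1 := h.deriv (P φ) s hs
    have h2 : ∫ τ in (0 : ℝ)..s, inner 𝕜 (P φ) (w' τ) = ∫ τ in (0 : ℝ)..s, innerSL 𝕜 φ (P (g τ)) := by
      refine intervalIntegral.integral_congr fun τ hτ => ?_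
      rw [uIcc_of_le hs.1] at hτ
      simp only [innerSL_apply_apply]
      rw [hg τ ⟨hτ.1, hτ.2.trans hs.2⟩, hP, inner_eigenProj_left]
    rw [h2, ContinuousLinearMap.intervalIntegral_comp_comm _ (hPg.intervalIntegrable _ _),
      innerSL_apply_apply, hP, inner_eigenProj_left, inner_eigenProj_left, ← inner_add_right] at h1
    exact h1
  have hq : ∀ s ∈ Icc 0 T, P (w' s) = q s := by
    intro s hs
    refine ext_inner_left 𝕜 fun φ => ?_
    obtain ⟨x, hx, hAx⟩ := hA.eigenProj_mem μ φ
    have h1 := h.equation x s hs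
    have h2 : ∫ τ in (0 : ℝ)..s, inner 𝕜 (A x) (w τ) =
        ∫ τ in (0 : ℝ)..s, innerSL 𝕜 φ (μ • P (k τ)) := by
      refine intervalIntegral.integral_congr fun τ hτ => ?_
      rw [uIcc_of_le hs.1] at hτ
      simp only [innerSL_apply_apply]
      rw [hk τ ⟨hτ.1, hτ.2.trans hs.2⟩, hAx, RCLike.real_smul_eq_coe_smul (K := 𝕜),
        inner_smul_left, RCLike.conj_ofReal, inner_smul_right, hP, inner_eigenProj_left]
    rw [h2, ContinuousLinearMap.intervalIntegral_comp_comm _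
      ((hPk.fun_const_smul μ).intervalIntegrable _ _), innerSL_apply_apply, hx, inner_eigenProj_left,
      inner_eigenProj_left, intervalIntegral.integral_smul, ← inner_sub_right] at h1
    simpa using h1
  have hp' : ∀ s ∈ Icc 0 T, HasDerivAt p (q s) s := by
    intro s hs
    have := ((hPg.integral_hasStrictDerivAt 0 s).hasDerivAt).const_add (P (w 0))
    rwa [hg s hs, hq s hs] at this
  have hq' : ∀ s ∈ Icc 0 T, HasDerivAt q (-(μ • p s)) s := by
    intro s hs
    have := (((hPk.integral_hasStrictDerivAt 0 s).hasDerivAt).const_smul μ).const_sub (P (w' 0))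
    rwa [hk s hs, hp s hs] at this
  have ec : ∀ s, HasDerivAt (fun s => Real.cos (r * s)) (-Real.sin (r * s) * (r * 1)) s :=
    fun s => ((hasDerivAt_id s).const_mul r).cos
  have es : ∀ s, HasDerivAt (fun s => Real.sin (r * s)) (Real.cos (r * s) * (r * 1)) s :=
    fun s => ((hasDerivAt_id s).const_mul r).sin
  -- The pair `(r p, q)` rotates with angular speed `r`. The two combinations below undo the
  -- rotation, so they are constant, and inverting them gives the formula for `q`.
  have ha : ∀ s ∈ Icc 0 T,
      HasDerivAt (fun s => Real.cos (r * s) • q s + r • Real.sin (r * s) • p s) 0 s := by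
    intro s hs
    refine (((ec s).smul (hq' s hs)).add (((es s).smul (hp' s hs)).const_smul r)).congr_deriv ?_
    rw [hrr]
    module
  have hb : ∀ s ∈ Icc 0 T,
      HasDerivAt (fun s => r • Real.cos (r * s) • p s - Real.sin (r * s) • q s) 0 s := by
    intro s hs
    refine ((((ec s).smul (hp' s hs)).const_smul r).sub ((es s).smul (hq' s hs))).congr_deriv ?_
    rw [hrr]
    module
  have ha' := constant_of_has_deriv_right_zero
    (fun s hs => (ha s hs).continuousAt.continuousWithinAt)
    (fun s hs => (ha s (Ico_subset_Icc_self hs)).hasDerivWithinAt) t ht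
  have hb' := constant_of_has_deriv_right_zero
    (fun s hs => (hb s hs).continuousAt.continuousWithinAt)
    (fun s hs => (hb s (Ico_subset_Icc_self hs)).hasDerivWithinAt) t ht
  have hp0 : p 0 = P (w 0) := by simp [p]
  have hq0 : q 0 = P (w' 0) := by simp [q]
  simp only [mul_zero, Real.cos_zero, Real.sin_zero, one_smul, zero_smul, smul_zero, add_zero,
    sub_zero, hp0, hq0] at ha' hb'
  rw [hq t ht, ← ha', ← hb']
  have hcs := Real.sin_sq_add_cos_sq (r * t)
  calc q t = (Real.sin (r * t) ^ 2 + Real.cos (r * t) ^ 2) • q t := by rw [hcs, one_smul]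
    _ = _ := by module

/-- Finite sums of these modes are the smooth solutions approximating an arbitrary free solution. -/
theorem A1.isSmoothSol_mode (hA : A1 A) (μ : ℝ) (x y : H) :
    IsSmoothSol hA (fun _ => 0) (fun t => Real.cos (√μ * t) • eigenProj A μ x +
      (Real.sin (√μ * t) / √μ) • eigenProj A μ y) ∧
    ∀ t, HasDerivAt (fun t => Real.cos (√μ * t) • eigenProj A μ x +
      (Real.sin (√μ * t) / √μ) • eigenProj A μ y)
      (Real.cos (√μ * t) • eigenProj A μ y - Real.sin (√μ * t) • √μ • eigenProj A μ x) t := by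
  rcases le_or_gt μ 0 with hμ | hμ
  · simp only [hA.eigenProj_eq_zero_of_nonpos hμ, smul_zero, add_zero, sub_zero]
    exact ⟨IsSmoothSol.zero, fun t => hasDerivAt_const _ _⟩
  have hinv : ∀ z, μ • hA.inv (eigenProj A μ z) = eigenProj A μ z := fun z => by
    rw [RCLike.real_smul_eq_coe_smul (K := 𝕜), hA.inv_eigenProj]
  set r := √μ with hr
  have hr0 : r ≠ 0 := (Real.sqrt_pos.2 hμ).ne'
  have hrr : μ = r * r := (Real.mul_self_sqrt hμ.le).symm
  set a := eigenProj A μ x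
  set b := eigenProj A μ y
  have ec : ∀ s, HasDerivAt (fun s => Real.cos (r * s)) (-Real.sin (r * s) * (r * 1)) s :=
    fun s => ((hasDerivAt_id s).const_mul r).cos
  have es : ∀ s, HasDerivAt (fun s => Real.sin (r * s)) (Real.cos (r * s) * (r * 1)) s :=
    fun s => ((hasDerivAt_id s).const_mul r).sin
  have h1 : ∀ t, HasDerivAt (fun t => Real.cos (r * t) • a + (Real.sin (r * t) / r) • b)
      (Real.cos (r * t) • b - Real.sin (r * t) • r • a) t := by
    intro t
    refine (((ec t).smul_const a).add (((es t).div_const r).smul_const b)).congr_deriv ?_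
    rw [show Real.cos (r * t) * (r * 1) / r = Real.cos (r * t) by field_simp]
    module
  have h2 : ∀ t, HasDerivAt (fun t => Real.cos (r * t) • b - Real.sin (r * t) • r • a)
      (-(μ • (Real.cos (r * t) • a + (Real.sin (r * t) / r) • b))) t := by
    intro t
    refine (((ec t).smul_const b).sub ((es t).smul_const (r • a))).congr_deriv ?_
    have : μ * (Real.sin (r * t) / r) = Real.sin (r * t) * r := by rw [hrr]; field_simp
    rw [smul_add, smul_smul μ (_ / _), this, hrr]
    module
  refine ⟨⟨contDiff_const, ?_, fun t => ?_⟩, h1⟩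
  · have hl : ContDiff ℝ ∞ fun t : ℝ => r * t := contDiff_const.mul contDiff_id
    exact (hl.cos.smul contDiff_const).add ((hl.sin.div_const r).smul contDiff_const)
  · have e1 := funext fun t => (h1 t).deriv
    rw [e1, (h2 t).deriv, zero_sub, neg_neg, ContinuousLinearMap.map_smul_of_tower, map_add,
      ContinuousLinearMap.map_smul_of_tower, ContinuousLinearMap.map_smul_of_tower, smul_add,
      smul_comm μ, hinv, smul_comm μ, hinv]

theorem IsSmoothSol.sum {ι : Type*} {hA : A1 A} {z : ι → ℝ → H} (F : Finset ι)
    (h : ∀ i ∈ F, IsSmoothSol hA (fun _ => 0) (z i)) :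
    IsSmoothSol hA (fun _ => 0) (fun t => ∑ i ∈ F, z i t) := by
  have hz := fun i hi => (contDiff_infty_iff_deriv.1 (h i hi).smooth).2
  refine ⟨contDiff_const, ContDiff.sum fun i hi => (h i hi).smooth, fun t => ?_⟩
  have e1 : _root_.deriv (fun t => ∑ i ∈ F, z i t) = fun t => ∑ i ∈ F, _root_.deriv (z i) t :=
    funext fun t =>
      (HasDerivAt.fun_sum fun i hi => hasDerivAt_of_contDiff (h i hi).smooth t).deriv
  rw [e1, (HasDerivAt.fun_sum fun i hi => hasDerivAt_of_contDiff (hz i hi) t).deriv, map_sub,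
    map_sum, map_zero, zero_sub, ← Finset.sum_neg_distrib]
  refine Finset.sum_congr rfl fun i hi => ?_
  rw [(h i hi).equation t, zero_sub, map_neg]

/-- An estimate for the velocities of free solutions, by density of the smooth ones. -/
theorem A1.energy_le_of_smooth (hA : A1 A) {T M : ℝ} (hT : 0 < T) (hM : 0 ≤ M) (L : H →L[𝕜] H)
    (hL : ∀ w : ℝ → H, IsSmoothSol hA (fun _ => 0) w →
      energy A 1 (w 0) (deriv w 0) ≤ M * ∫ t in (0 : ℝ)..T, ‖L (deriv w t)‖ ^ 2)
    {w w' : ℝ → H} (h : IsSol A T (fun _ => 0) w w') :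
    energy A 1 (w 0) (w' 0) ≤ M * ∫ t in (0 : ℝ)..T, ‖L (w' t)‖ ^ 2 := by
  have h00 : (0 : ℝ) ∈ Icc 0 T := ⟨le_rfl, hT.le⟩
  set v := w' 0 with hv
  set y := fracPow A (1 / 2) (w 0) with hy
  have hyμ : ∀ μ, eigenProj A μ y = √μ • eigenProj A μ (w 0) := fun μ => by
    rw [hy, hA.eigenProj_fracPow (h.mem 0 h00), Real.sqrt_eq_rpow,
      RCLike.real_smul_eq_coe_smul (K := 𝕜)]
  let S : Finset ℝ → H → H := fun F x => ∑ μ ∈ F, eigenProj A μ x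
  have hS : ∀ x, Tendsto (fun F => S F x) atTop (𝓝 x) := fun x => hA.hasSum_eigenProj x
  -- Bounds the truncation error of the velocity uniformly in time: each discarded mode is at most
  -- the sum of the initial modes of `v` and `y`, as sine and cosine are bounded by 1.
  let δ : Finset ℝ → ℝ := fun F => √(2 * ‖v - S F v‖ ^ 2 + 2 * ‖y - S F y‖ ^ 2)
  have hδ : Tendsto δ atTop (𝓝 0) := by
    have h1 : Tendsto (fun F => ‖v - S F v‖) atTop (𝓝 0) := by
      simpa using ((tendsto_const_nhds (x := v)).sub (hS v)).norm
    have h2 : Tendsto (fun F => ‖y - S F y‖) atTop (𝓝 0) := by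
      simpa using ((tendsto_const_nhds (x := y)).sub (hS y)).norm
    simpa using ((((h1.pow 2).const_mul 2).add ((h2.pow 2).const_mul 2)).sqrt)
  have hLc : ContinuousOn (fun t => ‖L (w' t)‖) (Icc 0 T) :=
    (L.continuous.comp_continuousOn h.cont').norm
  have hLi : IntervalIntegrable (fun t => ‖L (w' t)‖) volume 0 T :=
    hLc.intervalIntegrable_of_Icc hT.le
  have hLi2 : IntervalIntegrable (fun t => ‖L (w' t)‖ ^ 2) volume 0 T :=
    (hLc.pow 2).intervalIntegrable_of_Icc hT.le
  set I := ∫ t in (0 : ℝ)..T, ‖L (w' t)‖ ^ 2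
  set J := ∫ t in (0 : ℝ)..T, ‖L (w' t)‖
  have key : ∀ F, (‖S F y‖ ^ 2 + ‖S F v‖ ^ 2) / 2 ≤
      M * (I + 2 * (‖L‖ * δ F) * J + T * (‖L‖ * δ F) ^ 2) := by
    intro F
    let z : ℝ → ℝ → H := fun μ t => Real.cos (√μ * t) • eigenProj A μ (w 0) +
      (Real.sin (√μ * t) / √μ) • eigenProj A μ v
    have hz : IsSmoothSol hA (fun _ => 0) (fun t => ∑ μ ∈ F, z μ t) :=
      IsSmoothSol.sum F fun μ _ => (hA.isSmoothSol_mode μ (w 0) v).1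
    have hz' : ∀ t, deriv (fun t => ∑ μ ∈ F, z μ t) t = ∑ μ ∈ F,
        (Real.cos (√μ * t) • eigenProj A μ v - Real.sin (√μ * t) • eigenProj A μ y) := fun t => by
      simp only [hyμ]
      exact (HasDerivAt.fun_sum fun μ _ => (hA.isSmoothSol_mode μ (w 0) v).2 t).deriv
    have hzS : ∀ t ∈ Icc 0 T, deriv (fun t => ∑ μ ∈ F, z μ t) t = S F (w' t) := fun t ht => by
      rw [hz']
      exact Finset.sum_congr rfl fun μ _ => (h.eigenProj_velocity hA ht μ).symm
    have hdiff : ∀ t ∈ Icc 0 T, ‖S F (w' t) - w' t‖ ≤ δ F := by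
      intro t ht
      refine Real.le_sqrt_of_sq_le (hA.norm_sq_le_of_eigenProj fun μ => ?_)
      simp only [S, map_sub, hA.eigenProj_sum]
      by_cases hμ : μ ∈ F
      · simp [hμ]
      · simp only [hμ, if_false, zero_sub, norm_neg, sub_zero]
        rw [h.eigenProj_velocity hA ht μ]
        refine (norm_sub_le _ _).trans (add_le_add ?_ ?_)
        · rw [norm_smul]
          exact mul_le_of_le_one_left (norm_nonneg _) (Real.abs_cos_le_one _)
        · rw [norm_smul]
          exact mul_le_of_le_one_left (norm_nonneg _) (Real.abs_sin_le_one _)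
    have he : energy A 1 (∑ μ ∈ F, z μ 0) (deriv (fun t => ∑ μ ∈ F, z μ t) 0) =
        (‖S F y‖ ^ 2 + ‖S F v‖ ^ 2) / 2 := by
      have e1 : ∑ μ ∈ F, z μ 0 = S F (w 0) := by simp [z, S]
      have e2 : fracPow A (1 / 2) (S F (w 0)) = S F y := by
        refine (hA.fracPow_eq fun μ => ?_).2
        simp only [S, hA.eigenProj_sum]
        split_ifs
        · rw [hyμ, Real.sqrt_eq_rpow, RCLike.real_smul_eq_coe_smul (K := 𝕜)]
        · simp
      rw [hzS 0 h00, hA.energy_one, e1, e2]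
    have h1 := hL _ hz
    rw [he] at h1
    refine h1.trans (mul_le_mul_of_nonneg_left ?_ hM)
    have hc : Continuous fun t => ‖L (deriv (fun t => ∑ μ ∈ F, z μ t) t)‖ ^ 2 :=
      (L.continuous.comp (contDiff_infty_iff_deriv.1 hz.smooth).2.continuous).norm.pow 2
    have hle : ∫ t in (0 : ℝ)..T, ‖L (deriv (fun t => ∑ μ ∈ F, z μ t) t)‖ ^ 2 ≤
        ∫ t in (0 : ℝ)..T, (‖L (w' t)‖ ^ 2 + 2 * (‖L‖ * δ F) * ‖L (w' t)‖ + (‖L‖ * δ F) ^ 2) := by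
      refine intervalIntegral.integral_mono_on hT.le (hc.intervalIntegrable _ _)
        ((hLi2.add (hLi.const_mul _)).add intervalIntegrable_const) fun t ht => ?_
      rw [hzS t ht]
      have h2 : ‖L (S F (w' t))‖ ≤ ‖L (w' t)‖ + ‖L‖ * δ F := by
        calc ‖L (S F (w' t))‖ = ‖L (w' t) + L (S F (w' t) - w' t)‖ := by rw [← map_add]; simp
          _ ≤ ‖L (w' t)‖ + ‖L (S F (w' t) - w' t)‖ := norm_add_le _ _
          _ ≤ _ := by
            gcongr
            exact (L.le_opNorm _).trans
              (mul_le_mul_of_nonneg_left (hdiff t ht) (norm_nonneg _))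
      calc _ ≤ (‖L (w' t)‖ + ‖L‖ * δ F) ^ 2 := pow_le_pow_left₀ (norm_nonneg _) h2 2
        _ = _ := by ring
    refine hle.trans_eq ?_
    rw [intervalIntegral.integral_add (hLi2.add (hLi.const_mul _)) intervalIntegrable_const,
      intervalIntegral.integral_add hLi2 (hLi.const_mul _), intervalIntegral.integral_const_mul,
      intervalIntegral.integral_const, smul_eq_mul, sub_zero]
  rw [hA.energy_one]
  refine le_of_tendsto_of_tendsto' ((((hS y).norm.pow 2).add ((hS v).norm.pow 2)).div_const 2) ?_ key
  have hκ := hδ.const_mul ‖L‖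
  have := ((((hκ.const_mul 2).mul_const J).const_add I).add ((hκ.pow 2).const_mul T)).const_mul M
  simpa using this

end Density

/-! ### The two necessary conditions. -/

section Necessity

variable {𝕜 : Type*} [RCLike 𝕜] {H : Type*} [NormedAddCommGroup H] [InnerProductSpace 𝕜 H]
  [CompleteSpace H] {A : H →ₗ.[𝕜] H} {G : Type*} [NormedAddCommGroup G] [InnerProductSpace 𝕜 G]
  {B : A.domain × H →ₗ[𝕜] G}

theorem isSol_zero (A : H →ₗ.[𝕜] H) (T : ℝ) :
    IsSol A T (fun _ => 0) (fun _ => 0) (fun _ => 0) where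
  source := MemLp.zero'
  mem t _ := by simp [powDom, summable_zero]
  cont := continuousOn_const
  cont' := continuousOn_const
  deriv φ t _ := by simp
  equation φ t _ := by simp

/-- The observability of the cascade implies the observability of its last equation. -/
theorem A5_of_OBS {C : ℕ → H →L[𝕜] H} {n : ℕ} (hn : 2 ≤ n) {T₀ : ℝ} (hT₀ : 0 < T₀)
    (h : ∀ T, T₀ < T → OBS A C n B T) : A5 A B := by
  refine ⟨T₀, hT₀, fun T hT => ?_⟩
  obtain ⟨c, hc, hobs⟩ := h T hT
  refine ⟨c, hc, fun w w' y hw hy => ?_⟩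
  let u : ℕ → ℝ → H := fun j => if j = n then w else fun _ => 0
  let v : ℕ → ℝ → H := fun j => if j = n then w' else fun _ => 0
  have hun : u n = w := if_pos rfl
  have hvn : v n = w' := if_pos rfl
  have hu0 : ∀ j, j ≠ n → u j = fun _ => 0 := fun j hj => if_neg hj
  have hv0 : ∀ j, j ≠ n → v j = fun _ => 0 := fun j hj => if_neg hj
  have hsrc : ∀ j ∈ Finset.Icc 2 n, (fun t => -C j (u (j - 1) t)) = fun _ => 0 := fun j hj => by
    obtain ⟨h2, hjn⟩ := Finset.mem_Icc.1 hj
    rw [hu0 (j - 1) (by omega)]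
    simp
  have hcas : IsCascadeSol A C n T u v := by
    refine ⟨?_, fun j hj => ?_⟩
    · rw [hu0 1 (by omega), hv0 1 (by omega)]
      exact isSol_zero A T
    · rw [hsrc j hj]
      by_cases hjn : j = n
      · rw [hjn, hun, hvn]; exact hw
      · rw [hu0 j hjn, hv0 j hjn]; exact isSol_zero A T
  have h1 := hobs u v y hcas (by
    rw [hsrc n (Finset.mem_Icc.2 ⟨hn, le_rfl⟩), hun, hvn]; exact hy)
  refine le_trans (mul_le_mul_of_nonneg_left ?_ hc.le) h1
  have h2 := Finset.single_le_sum
    (f := fun j : ℕ => energy A (1 + (j : ℤ) - n) (u j 0) (v j 0))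
    (fun j _ => energy_nonneg _ _ _) (Finset.mem_Icc.2 ⟨by omega, le_refl n⟩ : n ∈ Finset.Icc 1 n)
  simpa [hun, hvn] using h2

/-- The observability of the cascade implies that of the free equation through the couplings. -/
theorem A3_of_OBS (hA : A1 A) (hB : A4 A B) {C : ℕ → H →L[𝕜] H} {n : ℕ} {T₀ : ℝ} (hT₀ : 0 < T₀)
    (h : ∀ T, T₀ < T → OBS A C n B T) : A3 A C n := by
  -- Calculus in time needs a real structure on `H` compatible with the one over `𝕜`.
  let _ : NormedSpace ℝ H := NormedSpace.restrictScalars ℝ 𝕜 H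
  have : IsScalarTower ℝ 𝕜 H := IsScalarTower.of_algebraMap_smul fun _ _ => rfl
  -- Observability of the cascade is used at time `T - 1`, the remaining unit being spent on the
  -- cutoff.
  refine fun i hi => ⟨T₀ + 1, by linarith, fun T hT => ?_⟩
  obtain ⟨M, hM, hle⟩ :=
    (h (T - 1) (by linarith)).exists_energy_le hA hB hi (by linarith : 0 < T - 1)
  rw [sub_add_cancel] at hle
  refine ⟨M⁻¹, inv_pos.2 hM, fun w w' hw => ?_⟩
  rw [inv_mul_le_iff₀ hM]
  exact hA.energy_le_of_smooth (by linarith) hM.le (C i) hle hw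

end Necessity

end Cascade

end

theorem theorem2p6 {𝕜 : Type*} [RCLike 𝕜]
    {H : Type*} [NormedAddCommGroup H] [InnerProductSpace 𝕜 H] [CompleteSpace H]
    {G : Type*} [NormedAddCommGroup G] [InnerProductSpace 𝕜 G] [CompleteSpace G]
    (A : H →ₗ.[𝕜] H) (n : ℕ) (hn : 2 ≤ n) (C : ℕ → H →L[𝕜] H) (B : A.domain × H →ₗ[𝕜] G)
    (hA1 : Cascade.A1 A) (hA2 : Cascade.A2 A C C n) (hA4 : Cascade.A4 A B)
    (hfail : ¬ Cascade.A5 A B ∨ ¬ Cascade.A3 A C n) :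
    ¬ ∃ Tstar : ℝ, 0 < Tstar ∧ ∀ T : ℝ, Tstar < T → Cascade.OBS A C n B T := by
  rintro ⟨T₀, hT₀, h⟩
  rcases hfail with hf | hf
  · exact hf (Cascade.A5_of_OBS hn hT₀ h)
  · exact hf (Cascade.A3_of_OBS hA1 hA4 hT₀ h)
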